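/- Let $\mathcal X=\mathbb C^N$, $\mathcal Y=\mathbb C^M$ with $NM\ge 2$; $\|\cdot\|$ is the spectral norm and $\langle A,B\rangle=\operatorname{Tr}(A^*B)$. An *interactive measurement operator* is an operator $Q=(\mathbb 1_{\mathcal Y}\otimes B^*)\,\Pi\,(\mathbb 1_{\mathcal Y}\otimes B)$ on $\mathcal Y\otimes\mathcal X$, where $\mathcal Z=\mathbb C^k$, $\sum_i|i\rangle|\psi_i\rangle\in\mathcal X\otimes\mathcal Z$ is a unit vector, $B=\sum_i|\psi_i\rangle\langle i|$, and $0\le\Pi\le\mathbb 1$ on $\mathcal Y\otimes\mathcal Z$. Put $\mu(Q)=\max_\Psi\langle Q,J(\Psi)\rangle$ over all quantum operations (completely positive trace-preserving maps) $\Psi:L(\mathcal X)\to L(\mathcal Y)$, where $J(\Psi)=\sum_{i,j}\Psi(|i\rangle\langle j|)\otimes|i\rangle\langle j|$. Let $Q$ be an invertible interactive measurement operator, $\varepsilon,\gamma>0$ real, and $$\Phi(X)=\operatorname{Tr}_{\mathcal Y}(Q^{-1/2}XQ^{-1/2}),\qquad \Phi^*(Y)=Q^{-1/2}(\mathbb 1_{\mathcal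 Y}\otimes Y)Q^{-1/2}.$$ Call $X$ *primal feasible* if $X\ge0$ and $\Phi(X)\le\mathbb 1_{\mathcal X}$, and $Y$ *dual feasible* if $Y\ge 0$ and $\Phi^*(Y)\ge\mathbb 1_{\mathcal Y\otimes\mathcal X}$. Let $\kappa(Q)=\|Q\|\|Q^{-1}\|$, $\delta=\varepsilon^2/(8\kappa(Q)^2)$, $T=\lceil 24\ln(NM)/(\varepsilon^3\gamma^3\delta)\rceil$, $\eta=\varepsilon\gamma/2$. *Algorithm.* For $t=0,\dots,T-1$: (a) with $W_t=\exp(-\eta\delta\,\Phi^*(Y_0+\cdots+Y_{t-1}))$ (so $W_0=\mathbb 1$) and $\rho_t=W_t/\operatorname{Tr}W_t$, compute a spectral decomposition $\Phi(\rho_t)=\sum_{j=1}^N\lambda_j|x_j\rangle\langle x_j|$; (b) let $S=\{j:\gamma\lambda_j>1\}$, $s=\sum_{j\in S}\lambda_j$; (c) if $s\le\delta\|Q^{-1}\|$, halt and accept; (d) let $Y_t=\frac1s\sum_{j\in S}|x_j\rangle\langle x_j|$. After iteration $T-1$, halt and reject. Then: 1. The maximum defining $\mu(Q)$ is attained. For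 every positive semidefinite $R$ on $\mathcal Y\otimes\mathcal X$, $|\mu(Q)-\mu(R)|\le N\|Q-R\|$; in particular $|\mu(Q)-\mu(R)|<\varepsilon\gamma$ if $\|Q-R\|<\varepsilon\gamma/N$. 2. Every run carries out at most $T$ iterations and accepts or rejects. If $\varepsilon,\gamma\le1$, then $T\le 25\ln(NM)/(\varepsilon^3\gamma^3\delta)$, so $T=O(\ln(NM)/(\varepsilon^3\gamma^3\delta))$. 3. (Exact computation.) An error-free run exists. For every error-free run, whatever spectral decompositions are chosen: if it accepts, there is a primal feasible $X$ with $\operatorname{Tr}X\ge(1-\varepsilon)\gamma$, and $\mu(Q)\ge(1-\varepsilon)\gamma$; if it rejects, there is a dual feasible $Y$ with $\operatorname{Tr}Y\le(1+\varepsilon)\gamma$, and $\mu(Q)\le(1+\varepsilon)\gamma$. 4. (Limited precision.) Consider a run in which, in iteration $t$, some stored operator $\widetilde\rho_t$ takes the place of $\rho_t$, and real numbers $\lambda_j$ and an orthonormal basis $(x_j)$ are used for which $\sum_j\lambda_j|x_j\rangle\langle x_j|$ is only an approximation of $\Phi(\widetilde\rho_t)$. - If it accepts in iteration $t$, $\widetilde\rho_t$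 is a density operator and $\|\Phi(\widetilde\rho_t)-\sum_j\lambda_j|x_j\rangle\langle x_j|\|<\delta/(4N\|Q^{-1}\|)$, then there is a primal feasible $X$ with $\operatorname{Tr}X\ge(1-2\varepsilon)\gamma$, and $\mu(Q)\ge(1-2\varepsilon)\gamma$. - If it rejects and, for all $t<T$, $\langle\rho_t,\Phi^*(Y_t)\rangle>1-\eta^2/12$, where $Y_t$ are the operators computed in the run and $\rho_t=W_t/\operatorname{Tr}W_t$ is formed exactly from $Y_0,\dots,Y_{t-1}$, then there is a dual feasible $Y$ with $\operatorname{Tr}Y\le(1+\varepsilon)\gamma$, and $\mu(Q)\le(1+\varepsilon)\gamma$. 5. These precision conditions can be met: there is $\tau>0$ (depending on $Q,\varepsilon,\gamma$) such that, if in every iteration $t$ carried out $\widetilde\rho_t=\widetilde W_t/\operatorname{Tr}\widetilde W_t$ with $\widetilde W_t$ Hermitian, $\|\widetilde W_t-W_t\|<\tau$, and the spectral decomposition has error $<\tau$ in spectral norm, then in every iteration carried out $\widetilde\rho_t$ is a density operator, the decomposition error is below $\delta/(4N\|Q^{-1}\|)$, and, unless the run accepts there, $\langle\rho_t,\Phi^*(Y_t)\rangle>1-\eta^2/12$.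 -/

import Mathlib

open scoped Matrix Kronecker ComplexOrder MatrixOrder Matrix.Norms.L2Operator

namespace QIP2

noncomputable section

/-! Throughout, `𝒳 = ℂ^N` and `𝒴 = ℂ^M`; operators on `𝒴 ⊗ 𝒳` are matrices indexed by
`Fin M × Fin N`, `≤` is the Loewner order and `‖·‖` is the spectral norm. -/

/-- Operators on `ℂ^N`. -/
abbrev Op (N : ℕ) : Type := Matrix (Fin N) (Fin N) ℂ

/-- Operators on `ℂ^M ⊗ ℂ^N`. -/
abbrev BiOp (M N : ℕ) : Type := Matrix (Fin M × Fin N) (Fin M × Fin N) ℂ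

/-- The (real part of the) Hilbert-Schmidt inner product `⟨A, B⟩ = Tr(A* B)`. -/
def hsInner {ι : Type} [Fintype ι] (A B : Matrix ι ι ℂ) : ℝ := ((Aᴴ * B).trace).re

/-- Density operators. -/
def IsDensity {ι : Type} [Fintype ι] (ρ : Matrix ι ι ℂ) : Prop :=
  ρ.PosSemidef ∧ ρ.trace = 1

/-- The partial trace `Tr_𝒴` on `𝒴 ⊗ 𝒳`. -/
def partialTrace {M N : ℕ} (A : BiOp M N) : Op N :=
  Matrix.of fun i j => ∑ a : Fin M, A (a, i) (a, j)

/-! ### Quantum operations and the maximum acceptance probability -/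

/-- `(Ψ ⊗ 𝟙_{L(ℂ^k)})(P)` for a super-operator `Ψ : L(𝒳) → L(𝒴)`. -/
def ampliation {M N : ℕ} (Ψ : Op N →ₗ[ℂ] Op M) (k : ℕ) (P : BiOp N k) : BiOp M k :=
  Matrix.of fun p q => Ψ (Matrix.of fun i j => P (i, p.2) (j, q.2)) p.1 q.1

/-- Completely positive super-operators. -/
def IsCompletelyPositive {M N : ℕ} (Ψ : Op N →ₗ[ℂ] Op M) : Prop :=
  ∀ (k : ℕ) (P : BiOp N k), P.PosSemidef → (ampliation Ψ k P).PosSemidef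

/-- Quantum operations: completely positive and trace-preserving super-operators. -/
def IsQuantumOperation {M N : ℕ} (Ψ : Op N →ₗ[ℂ] Op M) : Prop :=
  IsCompletelyPositive Ψ ∧ ∀ X : Op N, (Ψ X).trace = X.trace

/-- The Choi-Jamiołkowski representation `J(Ψ) = ∑ Ψ(|i⟩⟨j|) ⊗ |i⟩⟨j|`. -/
def choi {M N : ℕ} (Ψ : Op N →ₗ[ℂ] Op M) : BiOp M N :=
  ∑ i : Fin N, ∑ j : Fin N, Ψ (Matrix.single i j 1) ⊗ₖ Matrix.single i j (1 : ℂ)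

/-- The set of values `⟨Q, J(Ψ)⟩` over all quantum operations `Ψ`. -/
def acceptanceValues {M N : ℕ} (Q : BiOp M N) : Set ℝ :=
  {r | ∃ Ψ : Op N →ₗ[ℂ] Op M, IsQuantumOperation Ψ ∧ r = hsInner Q (choi Ψ)}

/-- `μ(Q)`, the maximum acceptance probability. -/
def mu {M N : ℕ} (Q : BiOp M N) : ℝ := sSup (acceptanceValues Q)

/-- `Q` is the interactive measurement operator `(𝟙 ⊗ B*) Π (𝟙 ⊗ B)` determined by a unit vector
`ψ ∈ 𝒳 ⊗ 𝒵` and a measurement operator `0 ≤ Π ≤ 𝟙` on `𝒴 ⊗ 𝒵`, where `𝒵 = ℂ^k`,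
`ψ = ∑ |i⟩|ψ_i⟩` and `B = ∑ |ψ_i⟩⟨i|`. -/
def IsInteractiveMeasurement {M N : ℕ} (Q : BiOp M N) : Prop :=
  ∃ (k : ℕ) (ψ : Fin N × Fin k → ℂ) (Pi : BiOp M k),
    ∑ p, ‖ψ p‖ ^ 2 = 1 ∧ 0 ≤ Pi ∧ Pi ≤ 1 ∧
    Q = ((1 : Op M) ⊗ₖ (Matrix.of fun (z : Fin k) (i : Fin N) => ψ (i, z))ᴴ) * Pi *
        ((1 : Op M) ⊗ₖ (Matrix.of fun (z : Fin k) (i : Fin N) => ψ (i, z)))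

/-! ### The semidefinite program -/

/-- `Q^{-1/2}`. -/
def invSqrt {M N : ℕ} (Q : BiOp M N) : BiOp M N := (CFC.sqrt Q)⁻¹

/-- `Φ(X) = Tr_𝒴(Q^{-1/2} X Q^{-1/2})`. -/
def Phi {M N : ℕ} (Q X : BiOp M N) : Op N := partialTrace (invSqrt Q * X * invSqrt Q)

/-- `Φ*(Y) = Q^{-1/2} (𝟙_𝒴 ⊗ Y) Q^{-1/2}`. -/
def PhiStar {M N : ℕ} (Q : BiOp M N) (Y : Op N) : BiOp M N :=
  invSqrt Q * ((1 : Op M) ⊗ₖ Y) * invSqrt Q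

/-- Feasibility for the primal problem: maximize `Tr X` subject to `Φ(X) ≤ 𝟙`, `X ≥ 0`. -/
def PrimalFeasible {M N : ℕ} (Q X : BiOp M N) : Prop := 0 ≤ X ∧ Phi Q X ≤ 1

/-- Feasibility for the dual problem: minimize `Tr Y` subject to `Φ*(Y) ≥ 𝟙`, `Y ≥ 0`. -/
def DualFeasible {M N : ℕ} (Q : BiOp M N) (Y : Op N) : Prop := 0 ≤ Y ∧ 1 ≤ PhiStar Q Y

/-! ### The algorithm -/

/-- The condition number `κ(Q) = ‖Q‖ ‖Q⁻¹‖`. -/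
def kappa {M N : ℕ} (Q : BiOp M N) : ℝ := ‖Q‖ * ‖Q⁻¹‖

/-- `δ = ε² / (8 κ(Q)²)`. -/
def delta {M N : ℕ} (Q : BiOp M N) (ε : ℝ) : ℝ := ε ^ 2 / (8 * kappa Q ^ 2)

/-- `T = ⌈24 ln(NM) / (ε³ γ³ δ)⌉`. -/
def bigT {M N : ℕ} (Q : BiOp M N) (ε γ : ℝ) : ℕ :=
  ⌈24 * Real.log ((N : ℝ) * M) / (ε ^ 3 * γ ^ 3 * delta Q ε)⌉₊

/-- What is computed in one iteration: the stored operator `rho`, and the spectral decomposition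
`∑ lam j |x_j⟩⟨x_j|` returned for `Φ(rho)`, where `x_j` is the `j`-th column of `U`. -/
structure Record (M N : ℕ) where
  rho : BiOp M N
  U : Matrix.unitaryGroup (Fin N) ℂ
  lam : Fin N → ℝ

namespace Record

variable {M N : ℕ}

/-- `|x_j⟩⟨x_j|`. -/
def ketbra (r : Record M N) (j : Fin N) : Op N :=
  Matrix.vecMulVec (fun i => (r.U : Op N) i j) (star fun i => (r.U : Op N) i j)

/-- The operator `∑ lam j |x_j⟩⟨x_j|`. -/
def decomp (r : Record M N) : Op N := ∑ j, (r.lam j : ℂ) • r.ketbra j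

/-- `S = {j : γ lam j > 1}`. -/
def bigS (γ : ℝ) (r : Record M N) : Finset (Fin N) := {j | γ * r.lam j > 1}

/-- `s = ∑_{j ∈ S} lam j`. -/
def smallS (γ : ℝ) (r : Record M N) : ℝ := ∑ j ∈ r.bigS γ, r.lam j

/-- The test `s ≤ δ ‖Q⁻¹‖`, which makes the algorithm halt and accept. -/
def AcceptTest (Q : BiOp M N) (ε γ : ℝ) (r : Record M N) : Prop :=
  r.smallS γ ≤ delta Q ε * ‖Q⁻¹‖

/-- `Y_t = (1/s) ∑_{j ∈ S} |x_j⟩⟨x_j|`. -/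
def Y (γ : ℝ) (r : Record M N) : Op N := ((1 / r.smallS γ : ℝ) : ℂ) • ∑ j ∈ r.bigS γ, r.ketbra j

end Record

/-! A run of the algorithm is a sequence `e` of records, one for each iteration; the entries after
the halting iteration play no role. -/

section Run

variable {M N : ℕ}

/-- `W_t = exp(-(εγδ/2) Φ*(Y_0 + ⋯ + Y_{t-1}))`; in particular `W_0 = 𝟙`. -/
def bigW (Q : BiOp M N) (ε γ : ℝ) (e : ℕ → Record M N) (t : ℕ) : BiOp M N :=
  NormedSpace.exp
    (((-(ε * γ * delta Q ε / 2) : ℝ) : ℂ) • PhiStar Q (∑ i ∈ Finset.range t, (e i).Y γ))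

/-- `W / Tr W`. -/
def normalize (W : BiOp M N) : BiOp M N := (W.trace)⁻¹ • W

/-- Iteration `t` is carried out: `t < T`, and the algorithm has not halted before. -/
def Reached (Q : BiOp M N) (ε γ : ℝ) (e : ℕ → Record M N) (t : ℕ) : Prop :=
  t < bigT Q ε γ ∧ ∀ i < t, ¬ (e i).AcceptTest Q ε γ

/-- The algorithm halts and accepts in iteration `t`. -/
def AcceptsAt (Q : BiOp M N) (ε γ : ℝ) (e : ℕ → Record M N) (t : ℕ) : Prop :=
  Reached Q ε γ e t ∧ (e t).AcceptTest Q ε γ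

/-- The algorithm goes through all `T` iterations without accepting, and rejects. -/
def Rejects (Q : BiOp M N) (ε γ : ℝ) (e : ℕ → Record M N) : Prop :=
  ∀ t < bigT Q ε γ, ¬ (e t).AcceptTest Q ε γ

/-- The number of iterations carried out. -/
def iterations (Q : BiOp M N) (ε γ : ℝ) (e : ℕ → Record M N) : ℕ :=
  {t | Reached Q ε γ e t}.ncard

/-- Error-free runs: `rho` is `ρ_t = W_t / Tr W_t` and the spectral decomposition is exact. -/
def IsExactRun (Q : BiOp M N) (ε γ : ℝ) (e : ℕ → Record M N) : Prop :=
  ∀ t, Reached Q ε γ e t →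
    (e t).rho = normalize (bigW Q ε γ e t) ∧ Phi Q (e t).rho = (e t).decomp

/-- Precision used for acceptance: the stored `rho` is some density operator, and the spectral
decomposition of `Φ(rho)` has error below `δ / (4 N ‖Q⁻¹‖)`. -/
def AcceptPrecision (Q : BiOp M N) (ε : ℝ) (r : Record M N) : Prop :=
  IsDensity r.rho ∧ ‖Phi Q r.rho - r.decomp‖ < delta Q ε / (4 * N * ‖Q⁻¹‖)

/-- Precision used for rejection: `⟨ρ_t, Φ*(Y_t)⟩ > 1 - η²/12` with `η = εγ/2`, where
`ρ_t = W_t / Tr W_t` is the exact operator determined by the computed `Y_0, …, Y_{t-1}`. -/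
def RejectPrecision (Q : BiOp M N) (ε γ : ℝ) (e : ℕ → Record M N) (t : ℕ) : Prop :=
  hsInner (normalize (bigW Q ε γ e t)) (PhiStar Q ((e t).Y γ)) > 1 - (ε * γ / 2) ^ 2 / 12

/-- Runs in which every matrix exponential and every spectral decomposition is computed up to an
error below `τ` in spectral norm. -/
def IsApproxRun (Q : BiOp M N) (ε γ τ : ℝ) (e : ℕ → Record M N) : Prop :=
  ∀ t, Reached Q ε γ e t →
    (∃ W : BiOp M N, W.IsHermitian ∧ ‖W - bigW Q ε γ e t‖ < τ ∧ (e t).rho = normalize W) ∧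
    ‖Phi Q (e t).rho - (e t).decomp‖ < τ

end Run

end

end QIP2

/-!
The weights `W_t = exp (-η ∑_{i<t} δ Φ*(Y_i))` are those of the matrix multiplicative weights
method. By the Golden–Thompson inequality, a round with `⟨ρ_t, Φ*(Y_t)⟩ ≈ 1` shrinks `Tr W_t` by a
factor of about `exp (-η δ)`. If the run never accepts, then after `T` rounds even the largest
eigenvalue `exp (-η δ λ_min (Φ*(∑ Y_t)))` of `W_T` is so small that `Φ*(∑ Y_t)` is at least
`T / (1 + ε)` times the identity. As each `Y_t` has trace at most `γ`, this makes `1 + ε` times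
their average a dual feasible operator of trace at most `(1 + ε) γ`.

If the run accepts at `ρ`, conjugating `γ ρ` by the projection onto the eigenvectors of `Φ(ρ)` with
eigenvalue at most `1 / γ` gives a primal feasible operator. The acceptance test bounds the weight
`s` of the discarded eigenvectors, and by the Cauchy–Schwarz inequality the fraction of the trace
lost in this way is of order `√(‖Q‖ s)`.

Finally, `μ(Q)` is attained because the Choi operators of quantum operations form a compact set, and
weak duality turns feasible operators into bounds on `μ(Q)`.
-/

namespace QIP2

open Filter Topology

section LieTrotter

variable {𝔸 : Type*} [NormedRing 𝔸]

theorem norm_pow_sub_pow_le [NormOneClass 𝔸] {a b : 𝔸} {c : ℝ} (ha : ‖a‖ ≤ c) (hb : ‖b‖ ≤ c)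
    (n : ℕ) : ‖a ^ n - b ^ n‖ ≤ n * c ^ (n - 1) * ‖a - b‖ := by
  induction n with
  | zero => simp
  | succ n ih =>
    have hfirst : ‖(a ^ n - b ^ n) * a‖ ≤ n * c ^ n * ‖a - b‖ := by
      rcases eq_or_ne n 0 with rfl | hn
      · simp
      calc ‖(a ^ n - b ^ n) * a‖ ≤ (n * c ^ (n - 1) * ‖a - b‖) * c :=
            norm_mul_le_of_le ih ha
        _ = n * (c ^ (n - 1) * c) * ‖a - b‖ := by ring
        _ = n * c ^ n * ‖a - b‖ := by rw [pow_sub_one_mul hn]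
    have hsecond : ‖b ^ n * (a - b)‖ ≤ c ^ n * ‖a - b‖ :=
      norm_mul_le_of_le ((norm_pow_le b n).trans (pow_le_pow_left₀ (norm_nonneg b) hb n)) le_rfl
    calc ‖a ^ (n + 1) - b ^ (n + 1)‖ = ‖(a ^ n - b ^ n) * a + b ^ n * (a - b)‖ := by
          rw [pow_succ, pow_succ]; congr 1; noncomm_ring
      _ ≤ n * c ^ n * ‖a - b‖ + c ^ n * ‖a - b‖ := norm_add_le_of_le hfirst hsecond
      _ = (n + 1 : ℕ) * c ^ (n + 1 - 1) * ‖a - b‖ := by rw [Nat.add_sub_cancel]; push_cast; ring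

variable [NormedAlgebra ℝ 𝔸]

theorem norm_exp_le [NormOneClass 𝔸] (a : 𝔸) : ‖NormedSpace.exp a‖ ≤ Real.exp ‖a‖ := by
  rw [NormedSpace.exp_eq_tsum ℝ, Real.exp_eq_exp_ℝ]
  refine tsum_of_norm_bounded (NormedSpace.expSeries_div_hasSum_exp ‖a‖) fun n => ?_
  rw [norm_smul, norm_inv, Real.norm_natCast, inv_mul_eq_div]
  gcongr
  exact norm_pow_le a n

variable [CompleteSpace 𝔸]

theorem exp_inv_smul_pow (a : 𝔸) {n : ℕ} (hn : n ≠ 0) :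
    NormedSpace.exp ((n : ℝ)⁻¹ • a) ^ n = NormedSpace.exp a := by
  let _ : NormedAlgebra ℚ 𝔸 := NormedAlgebra.restrictScalars ℚ ℝ 𝔸
  rw [← NormedSpace.exp_nsmul, ← Nat.cast_smul_eq_nsmul ℝ,
    smul_inv_smul₀ (Nat.cast_ne_zero.mpr hn)]

theorem tendsto_mul_norm_exp_mul_exp_sub_exp_add (a b : 𝔸) :
    Tendsto (fun n : ℕ => n * ‖NormedSpace.exp ((n : ℝ)⁻¹ • a) * NormedSpace.exp ((n : ℝ)⁻¹ • b) -
      NormedSpace.exp ((n : ℝ)⁻¹ • (a + b))‖) atTop (𝓝 0) := by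
  have hexp (c : 𝔸) : HasDerivAt (fun s : ℝ => NormedSpace.exp (s • c)) c 0 := by
    simpa using hasDerivAt_exp_smul_const (𝕂 := ℝ) c 0
  have hdiff : HasDerivAt (fun s : ℝ => NormedSpace.exp (s • a) * NormedSpace.exp (s • b) -
      NormedSpace.exp (s • (a + b))) 0 0 := by
    simpa using ((hexp a).fun_mul (hexp b)).fun_sub (hexp (a + b))
  have hinv : Tendsto (fun n : ℕ => (n : ℝ)⁻¹) atTop (𝓝[≠] 0) :=
    (tendsto_inv_atTop_nhdsGT_zero.comp tendsto_natCast_atTop_atTop).mono_right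
      (nhdsWithin_mono 0 fun _ hs => hs.ne')
  simpa [Function.comp_def, norm_smul] using (hdiff.tendsto_slope_zero.comp hinv).norm

theorem lie_trotter [NormOneClass 𝔸] (a b : 𝔸) :
    Tendsto (fun n : ℕ => (NormedSpace.exp ((n : ℝ)⁻¹ • a) * NormedSpace.exp ((n : ℝ)⁻¹ • b)) ^ n)
      atTop (𝓝 (NormedSpace.exp (a + b))) := by
  rw [tendsto_iff_norm_sub_tendsto_zero]
  have hlim := (tendsto_mul_norm_exp_mul_exp_sub_exp_add a b).const_mul (Real.exp (‖a‖ + ‖b‖))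
  rw [mul_zero] at hlim
  refine squeeze_zero' (.of_forall fun _ => norm_nonneg _) ?_ hlim
  filter_upwards [eventually_ne_atTop 0] with n hn
  have hscale (x : 𝔸) : ‖(n : ℝ)⁻¹ • x‖ = (n : ℝ)⁻¹ * ‖x‖ := by simp [norm_smul]
  set c : ℝ := Real.exp ((n : ℝ)⁻¹ * (‖a‖ + ‖b‖))
  have hprod : ‖NormedSpace.exp ((n : ℝ)⁻¹ • a) * NormedSpace.exp ((n : ℝ)⁻¹ • b)‖ ≤ c := by
    refine (norm_mul_le_of_le (norm_exp_le _) (norm_exp_le _)).trans_eq ?_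
    rw [← Real.exp_add, hscale, hscale, ← mul_add]
  have hsum : ‖NormedSpace.exp ((n : ℝ)⁻¹ • (a + b))‖ ≤ c := by
    refine (norm_exp_le _).trans (Real.exp_le_exp.mpr ?_)
    rw [hscale]
    gcongr
    exact norm_add_le a b
  have hc : c ^ (n - 1) ≤ Real.exp (‖a‖ + ‖b‖) := by
    calc c ^ (n - 1) ≤ c ^ n := pow_le_pow_right₀ (Real.one_le_exp (by positivity)) n.pred_le
      _ = Real.exp (‖a‖ + ‖b‖) := by
        rw [← Real.exp_nat_mul, mul_inv_cancel_left₀ (Nat.cast_ne_zero.mpr hn)]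
  rw [← exp_inv_smul_pow (a + b) hn]
  refine (norm_pow_sub_pow_le hprod hsum n).trans ?_
  rw [mul_comm (n : ℝ), mul_assoc]
  gcongr

end LieTrotter

section GoldenThompson

variable {ι : Type*} [Fintype ι]

theorem trace_mul_pow_comm [DecidableEq ι] {R : Type*} [CommSemiring R] (A B : Matrix ι ι R)
    (n : ℕ) : ((A * B) ^ n).trace = ((B * A) ^ n).trace := by
  cases n with
  | zero => simp
  | succ n => rw [pow_succ, ← mul_assoc, mul_pow_mul, mul_assoc, Matrix.trace_mul_comm, mul_assoc,
      ← pow_succ]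

theorem two_mul_trace_mul_re_le (A B : Matrix ι ι ℂ) :
    2 * (A * B).trace.re ≤ (A * Aᴴ).trace.re + (Bᴴ * B).trace.re := by
  have hsq : 0 ≤ ((A - Bᴴ) * (A - Bᴴ)ᴴ).trace.re :=
    (Complex.nonneg_iff.mp (Matrix.posSemidef_self_mul_conjTranspose _).trace_nonneg).1
  have hcross : (Bᴴ * Aᴴ).trace.re = (A * B).trace.re := by
    rw [← Matrix.conjTranspose_mul, Matrix.trace_conjTranspose, Complex.star_def, Complex.conj_re]
  simp only [Matrix.conjTranspose_sub, Matrix.conjTranspose_conjTranspose, sub_mul, mul_sub,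
    Matrix.trace_sub, Complex.sub_re, hcross] at hsq
  linarith

variable [DecidableEq ι]

-- Neither inequality can be proved alone: the step to `k + 1` of each uses both at `k`.
theorem trace_pow_re_le_and_trace_mul_pow_re_le (k : ℕ) :
    (∀ Z : Matrix ι ι ℂ, (Z ^ 2 ^ (k + 1)).trace.re ≤ ((Z * Zᴴ) ^ 2 ^ k).trace.re) ∧
    (∀ X Y : Matrix ι ι ℂ, X.IsHermitian → Y.IsHermitian →
      ((X * Y) ^ 2 ^ k).trace.re ≤ (X ^ 2 ^ k * Y ^ 2 ^ k).trace.re) := by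
  induction k with
  | zero =>
    refine ⟨fun Z => ?_, fun X Y _ _ => by simp⟩
    have hcauchy := two_mul_trace_mul_re_le Z Z
    rw [Matrix.trace_mul_comm Zᴴ Z] at hcauchy
    simp only [zero_add, pow_one, pow_zero, pow_two]
    linarith
  | succ k ih =>
    obtain ⟨ih_pow, ih_mul⟩ := ih
    constructor
    · intro Z
      have hX := Matrix.isHermitian_mul_conjTranspose_self Z
      have hY := Matrix.isHermitian_conjTranspose_mul_self Z
      have hcauchy := two_mul_trace_mul_re_le ((Z * Zᴴ) ^ 2 ^ k) ((Zᴴ * Z) ^ 2 ^ k)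
      rw [(hX.pow _).eq, (hY.pow _).eq, ← pow_add, ← pow_add, ← two_mul, ← pow_succ',
        trace_mul_pow_comm Zᴴ Z] at hcauchy
      calc (Z ^ 2 ^ (k + 1 + 1)).trace.re = ((Z ^ 2) ^ 2 ^ (k + 1)).trace.re := by
            rw [← pow_mul, ← pow_succ']
        _ ≤ ((Z ^ 2 * (Z ^ 2)ᴴ) ^ 2 ^ k).trace.re := ih_pow _
        _ = ((Z * Zᴴ * (Zᴴ * Z)) ^ 2 ^ k).trace.re := by
            rw [pow_two, Matrix.conjTranspose_mul, mul_assoc, trace_mul_pow_comm]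
            simp only [mul_assoc]
        _ ≤ ((Z * Zᴴ) ^ 2 ^ k * (Zᴴ * Z) ^ 2 ^ k).trace.re := ih_mul _ _ hX hY
        _ ≤ ((Z * Zᴴ) ^ 2 ^ (k + 1)).trace.re := by linarith
    · intro X Y hX hY
      calc ((X * Y) ^ 2 ^ (k + 1)).trace.re ≤ ((X * Y * (X * Y)ᴴ) ^ 2 ^ k).trace.re := ih_pow _
        _ = ((X ^ 2 * Y ^ 2) ^ 2 ^ k).trace.re := by
            rw [Matrix.conjTranspose_mul, hX.eq, hY.eq, mul_assoc, trace_mul_pow_comm,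
              trace_mul_pow_comm (X ^ 2)]
            simp only [pow_two, mul_assoc]
        _ ≤ ((X ^ 2) ^ 2 ^ k * (Y ^ 2) ^ 2 ^ k).trace.re := ih_mul _ _ (hX.pow 2) (hY.pow 2)
        _ = (X ^ 2 ^ (k + 1) * Y ^ 2 ^ (k + 1)).trace.re := by
            rw [← pow_mul, ← pow_mul, ← pow_succ']

theorem golden_thompson {A B : Matrix ι ι ℂ} (hA : A.IsHermitian) (hB : B.IsHermitian) :
    (NormedSpace.exp (A + B)).trace.re ≤ (NormedSpace.exp A * NormedSpace.exp B).trace.re := by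
  cases isEmpty_or_nonempty ι
  · simp [Matrix.trace]
  have htrotter :=
    (lie_trotter A B).comp (tendsto_pow_atTop_atTop_of_one_lt (one_lt_two : 1 < 2))
  have hcont : Continuous fun X : Matrix ι ι ℂ => X.trace.re :=
    Complex.continuous_re.comp continuous_id.matrix_trace
  refine le_of_tendsto ((hcont.tendsto _).comp htrotter) (.of_forall fun k => ?_)
  have hn : 2 ^ k ≠ 0 := by positivity
  have hbound := (trace_pow_re_le_and_trace_mul_pow_re_le k).2 _ _
    (hA.smul (IsSelfAdjoint.all ((2 ^ k : ℕ) : ℝ)⁻¹)).exp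
    (hB.smul (IsSelfAdjoint.all ((2 ^ k : ℕ) : ℝ)⁻¹)).exp
  rwa [exp_inv_smul_pow A hn, exp_inv_smul_pow B hn] at hbound

end GoldenThompson

section LoewnerOrder

variable {ι : Type*} [Fintype ι]

theorem trace_smul_re (r : ℝ) (A : Matrix ι ι ℂ) : (r • A).trace.re = r * A.trace.re := by
  rw [Matrix.trace_smul, Complex.smul_re, smul_eq_mul]

theorem conjTranspose_mul_mul_mono {κ : Type*} [Finite κ] {A B : Matrix ι ι ℂ} (hAB : A ≤ B)
    (C : Matrix ι κ ℂ) : Cᴴ * A * C ≤ Cᴴ * B * C := by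
  have := Fintype.ofFinite κ
  rw [Matrix.le_iff] at hAB ⊢
  simpa only [Matrix.mul_sub, Matrix.sub_mul] using hAB.conjTranspose_mul_mul_same C

theorem trace_re_nonneg {A : Matrix ι ι ℂ} (hA : 0 ≤ A) : 0 ≤ A.trace.re :=
  (Complex.nonneg_iff.mp (Matrix.nonneg_iff_posSemidef.mp hA).trace_nonneg).1

theorem trace_re_mono {A B : Matrix ι ι ℂ} (hAB : A ≤ B) : A.trace.re ≤ B.trace.re := by
  simpa [Matrix.trace_sub] using trace_re_nonneg (sub_nonneg.mpr hAB)

theorem trace_mul_re_nonneg {A B : Matrix ι ι ℂ} (hA : 0 ≤ A) (hB : 0 ≤ B) :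
    0 ≤ (A * B).trace.re := by
  classical
  obtain ⟨C, rfl⟩ := CStarAlgebra.nonneg_iff_eq_mul_star_self.mp hB
  rw [← mul_assoc, Matrix.trace_mul_comm, ← mul_assoc]
  exact trace_re_nonneg (star_left_conjugate_nonneg hA C)

theorem trace_mul_re_mono {A B C : Matrix ι ι ℂ} (hAB : A ≤ B) (hC : 0 ≤ C) :
    (A * C).trace.re ≤ (B * C).trace.re := by
  simpa [sub_mul, Matrix.trace_sub] using trace_mul_re_nonneg (sub_nonneg.mpr hAB) hC

variable [DecidableEq ι]

theorem trace_one_re : (1 : Matrix ι ι ℂ).trace.re = Fintype.card ι := by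
  simp [Matrix.trace_one]

theorem le_norm_smul_one {A : Matrix ι ι ℂ} (hA : A.IsHermitian) : A ≤ ‖A‖ • 1 := by
  rw [← Algebra.algebraMap_eq_smul_one]
  exact IsSelfAdjoint.le_algebraMap_norm_self hA

theorem abs_trace_mul_re_le (A : Matrix ι ι ℂ) {B : Matrix ι ι ℂ} (hB : 0 ≤ B) :
    |(A * B).trace.re| ≤ ‖A‖ * B.trace.re := by
  have hupper (C : Matrix ι ι ℂ) : (C * B).trace.re ≤ ‖C‖ * B.trace.re := by
    have hadjoint : (Cᴴ * B).trace.re = (C * B).trace.re := by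
      rw [← hB.isSelfAdjoint.isHermitian.eq, ← Matrix.conjTranspose_mul,
        Matrix.trace_conjTranspose, hB.isSelfAdjoint.isHermitian.eq, Matrix.trace_mul_comm,
        Complex.star_def, Complex.conj_re]
    have hreal : ((realPart C : Matrix ι ι ℂ) * B).trace.re = (C * B).trace.re := by
      rw [realPart_apply_coe, smul_mul_assoc, add_mul, trace_smul_re, Matrix.trace_add,
        Complex.add_re, Matrix.star_eq_conjTranspose, hadjoint]
      ring
    calc (C * B).trace.re = ((realPart C : Matrix ι ι ℂ) * B).trace.re := hreal.symm
      _ ≤ ((‖(realPart C : Matrix ι ι ℂ)‖ • 1) * B).trace.re :=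
        trace_mul_re_mono (le_norm_smul_one (realPart C).2) hB
      _ = ‖(realPart C : Matrix ι ι ℂ)‖ * B.trace.re := by
        rw [smul_mul_assoc, one_mul, trace_smul_re]
      _ ≤ ‖C‖ * B.trace.re := mul_le_mul_of_nonneg_right (realPart.norm_le C) (trace_re_nonneg hB)
  have hlower := hupper (-A)
  rw [norm_neg, neg_mul, Matrix.trace_neg, Complex.neg_re] at hlower
  exact abs_le.mpr ⟨by linarith, hupper A⟩

theorem abs_trace_re_le (A : Matrix ι ι ℂ) : |A.trace.re| ≤ Fintype.card ι * ‖A‖ := by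
  simpa only [mul_one, trace_one_re, mul_comm] using abs_trace_mul_re_le A (B := 1) zero_le_one

theorem le_trace_smul_one {A : Matrix ι ι ℂ} (hA : 0 ≤ A) : A ≤ A.trace.re • 1 := by
  have hpsd := Matrix.nonneg_iff_posSemidef.mp hA
  rw [← Algebra.algebraMap_eq_smul_one]
  refine le_algebraMap_of_spectrum_le (fun x hx => ?_) hpsd.isHermitian
  rw [hpsd.isHermitian.spectrum_real_eq_range_eigenvalues] at hx
  obtain ⟨i, rfl⟩ := hx
  rw [hpsd.isHermitian.trace_eq_sum_eigenvalues]
  simp only [Complex.coe_algebraMap, Complex.re_sum, Complex.ofReal_re]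
  exact Finset.single_le_sum (fun j _ => hpsd.eigenvalues_nonneg j) (Finset.mem_univ i)

theorem norm_le_of_le_smul_one {A : Matrix ι ι ℂ} (hA : 0 ≤ A) {r : ℝ} (hr : 0 ≤ r)
    (hAr : A ≤ r • 1) : ‖A‖ ≤ r := by
  rwa [CStarAlgebra.norm_le_iff_le_algebraMap A hr hA, Algebra.algebraMap_eq_smul_one]

theorem norm_le_trace_re {A : Matrix ι ι ℂ} (hA : 0 ≤ A) : ‖A‖ ≤ A.trace.re :=
  norm_le_of_le_smul_one hA (trace_re_nonneg hA) (le_trace_smul_one hA)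

theorem real_exp_le_one_add_exp_neg_mul {c x : ℝ} (hcx : -c ≤ x) (hx : x ≤ 0) :
    Real.exp x ≤ 1 + Real.exp (-c) * x := by
  have htangent : Real.exp x * (1 - x) ≤ 1 := by
    calc Real.exp x * (1 - x) ≤ Real.exp x * Real.exp (-x) := by
          gcongr
          linarith [Real.add_one_le_exp (-x)]
      _ = 1 := by rw [← Real.exp_add, add_neg_cancel, Real.exp_zero]
  have hslope : Real.exp x * x ≤ Real.exp (-c) * x :=
    mul_le_mul_of_nonpos_right (Real.exp_le_exp.mpr hcx) hx
  linarith

theorem exp_le_one_add_exp_neg_smul {A : Matrix ι ι ℂ} {c : ℝ} (hcA : -(c • 1) ≤ A)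
    (hA : A ≤ 0) : NormedSpace.exp A ≤ 1 + Real.exp (-c) • A := by
  have hAsa : IsSelfAdjoint A := by simpa using (neg_nonneg.mpr hA).isSelfAdjoint.neg
  rw [← neg_smul, ← Algebra.algebraMap_eq_smul_one, algebraMap_le_iff_le_spectrum hAsa] at hcA
  rw [← map_zero (algebraMap ℝ (Matrix ι ι ℂ)), le_algebraMap_iff_spectrum_le hAsa] at hA
  have hline : 1 + Real.exp (-c) • A = cfc (fun x : ℝ => 1 + Real.exp (-c) * x) A := by
    rw [cfc_const_add (1 : ℝ) (fun x : ℝ => Real.exp (-c) * x) A, cfc_const_mul_id _ _ hAsa,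
      map_one]
  rw [hline, ← CFC.real_exp_eq_normedSpace_exp (a := A) hAsa]
  exact cfc_mono fun x hx => real_exp_le_one_add_exp_neg_mul (hcA x hx) (hA x hx)

theorem exp_smul_one_le_exp {A : Matrix ι ι ℂ} (hA : A.IsHermitian) {c : ℝ} (hcA : c • 1 ≤ A) :
    Real.exp c • 1 ≤ NormedSpace.exp A := by
  rw [← Algebra.algebraMap_eq_smul_one, algebraMap_le_iff_le_spectrum hA] at hcA
  rw [← Algebra.algebraMap_eq_smul_one, ← CFC.real_exp_eq_normedSpace_exp (a := A) hA]
  exact algebraMap_le_cfc _ _ _ fun x hx => Real.exp_le_exp.mpr (hcA x hx)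

theorem le_smul_one_of_trace_exp_le {A : Matrix ι ι ℂ} (hA : A.IsHermitian) {c : ℝ}
    (hexp : (NormedSpace.exp A).trace.re ≤ Real.exp c) : A ≤ c • 1 := by
  have hle : NormedSpace.exp A ≤ Real.exp c • 1 :=
    (le_trace_smul_one hA.isSelfAdjoint.exp_nonneg).trans
      (smul_le_smul_of_nonneg_right hexp zero_le_one)
  rw [← Algebra.algebraMap_eq_smul_one, ← CFC.real_exp_eq_normedSpace_exp (a := A) hA,
    cfc_le_algebraMap_iff Real.exp (Real.exp c) A] at hle
  rw [← Algebra.algebraMap_eq_smul_one, le_algebraMap_iff_spectrum_le hA]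
  exact fun x hx => Real.exp_le_exp.mp (hle x hx)

end LoewnerOrder

section ChoiOperators

variable {M N : ℕ}

theorem partialTrace_apply (A : BiOp M N) (i j : Fin N) :
    partialTrace A i j = ∑ a : Fin M, A (a, i) (a, j) := rfl

theorem partialTrace_add (A B : BiOp M N) :
    partialTrace (A + B) = partialTrace A + partialTrace B := by
  ext i j
  simp [partialTrace_apply, Finset.sum_add_distrib]

theorem partialTrace_smul (r : ℝ) (A : BiOp M N) :
    partialTrace (r • A) = r • partialTrace A := by
  ext i j
  simp [partialTrace_apply, Finset.mul_sum]

theorem partialTrace_conjTranspose (A : BiOp M N) : partialTrace Aᴴ = (partialTrace A)ᴴ := by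
  ext i j
  simp [partialTrace_apply]

theorem partialTrace_one_kronecker (Y : Op N) :
    partialTrace ((1 : Op M) ⊗ₖ Y) = (M : ℝ) • Y := by
  ext i j
  simp [partialTrace_apply, Matrix.kroneckerMap_apply]

theorem trace_partialTrace (A : BiOp M N) : (partialTrace A).trace = A.trace := by
  simp only [Matrix.trace, Matrix.diag, partialTrace_apply, Fintype.sum_prod_type]
  exact Finset.sum_comm

theorem mul_one_kronecker_apply (A : BiOp M N) (Y : Op N) (p : Fin M × Fin N) (b : Fin M)
    (j : Fin N) : (A * ((1 : Op M) ⊗ₖ Y)) p (b, j) = ∑ k, A p (b, k) * Y k j := by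
  simp [Matrix.mul_apply, Fintype.sum_prod_type, Matrix.kroneckerMap_apply, Matrix.one_apply]

theorem partialTrace_mul_one_kronecker (A : BiOp M N) (Y : Op N) :
    partialTrace (A * ((1 : Op M) ⊗ₖ Y)) = partialTrace A * Y := by
  ext i j
  simp only [partialTrace_apply, mul_one_kronecker_apply]
  simp only [Matrix.mul_apply, partialTrace_apply, Finset.sum_mul]
  exact Finset.sum_comm

theorem partialTrace_one_kronecker_mul (A : BiOp M N) (Y : Op N) :
    partialTrace (((1 : Op M) ⊗ₖ Y) * A) = Y * partialTrace A := by
  have hadjoint := partialTrace_mul_one_kronecker Aᴴ Yᴴ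
  rw [← Matrix.conjTranspose_inj, ← partialTrace_conjTranspose, Matrix.conjTranspose_mul,
    Matrix.conjTranspose_mul, Matrix.conjTranspose_kronecker, Matrix.conjTranspose_one, hadjoint,
    partialTrace_conjTranspose]

theorem one_kronecker_nonneg {Y : Op N} (hY : 0 ≤ Y) : 0 ≤ (1 : Op M) ⊗ₖ Y :=
  Matrix.nonneg_iff_posSemidef.mpr
    (Matrix.PosSemidef.one.kronecker (Matrix.nonneg_iff_posSemidef.mp hY))

theorem one_kronecker_isHermitian {Y : Op N} (hY : Y.IsHermitian) :
    ((1 : Op M) ⊗ₖ Y).IsHermitian := by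
  rw [Matrix.IsHermitian, Matrix.conjTranspose_kronecker, hY.eq, Matrix.conjTranspose_one]

theorem choi_apply (Ψ : Op N →ₗ[ℂ] Op M) (a b : Fin M) (i j : Fin N) :
    choi Ψ (a, i) (b, j) = Ψ (Matrix.single i j 1) a b := by
  simp [choi, Matrix.sum_apply, Matrix.kroneckerMap_apply, Matrix.single_apply, ite_and]

theorem choi_nonneg {Ψ : Op N →ₗ[ℂ] Op M} (hΨ : IsCompletelyPositive Ψ) : 0 ≤ choi Ψ := by
  let v : Fin N × Fin N → ℂ := fun p => if p.1 = p.2 then 1 else 0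
  have hchoi : choi Ψ = ampliation Ψ N (Matrix.vecMulVec v (star v)) := by
    ext ⟨a, i⟩ ⟨b, j⟩
    have hsingle : Matrix.single i j (1 : ℂ) =
        Matrix.of fun k l => Matrix.vecMulVec v (star v) (k, i) (l, j) := by
      ext k l
      by_cases hik : i = k <;> by_cases hjl : j = l <;>
        simp [Matrix.vecMulVec_apply, v, hik, hjl, Ne.symm]
    rw [choi_apply, hsingle]
    rfl
  rw [hchoi]
  exact Matrix.nonneg_iff_posSemidef.mpr
    (hΨ N _ (Matrix.posSemidef_vecMulVec_self_star v))

theorem partialTrace_choi {Ψ : Op N →ₗ[ℂ] Op M} (hΨ : ∀ X : Op N, (Ψ X).trace = X.trace) :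
    partialTrace (choi Ψ) = 1 := by
  ext i j
  calc partialTrace (choi Ψ) i j = (Ψ (Matrix.single i j 1)).trace := by
        simp only [partialTrace_apply, choi_apply, Matrix.trace, Matrix.diag]
    _ = (Matrix.single i j (1 : ℂ)).trace := hΨ _
    _ = (1 : Op N) i j := by
        rcases eq_or_ne i j with rfl | hij
        · rw [Matrix.trace_single_eq_same, Matrix.one_apply_eq]
        · rw [Matrix.trace_single_eq_of_ne _ _ _ hij, Matrix.one_apply_ne hij]

/-- The super-operator `X ↦ Tr_𝒳(J (𝟙 ⊗ Xᵀ))` with Choi–Jamiołkowski representation `J`: the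
inverse of `choi`, which turns an optimal operator into an optimal quantum operation. -/
noncomputable def ofChoi (J : BiOp M N) : Op N →ₗ[ℂ] Op M where
  toFun X := Matrix.of fun a b => ∑ i, ∑ j, X i j * J (a, i) (b, j)
  map_add' X Y := by
    ext a b
    simp [add_mul, Finset.sum_add_distrib]
  map_smul' c X := by
    ext a b
    simp [mul_assoc, Finset.mul_sum]

theorem ofChoi_apply (J : BiOp M N) (X : Op N) (a b : Fin M) :
    ofChoi J X a b = ∑ i, ∑ j, X i j * J (a, i) (b, j) := rfl

theorem choi_ofChoi (J : BiOp M N) : choi (ofChoi J) = J := by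
  ext ⟨a, i⟩ ⟨b, j⟩
  simp [choi_apply, ofChoi_apply, Matrix.single_apply, ite_and]

theorem isCompletelyPositive_ofChoi {J : BiOp M N} (hJ : 0 ≤ J) :
    IsCompletelyPositive (ofChoi J) := by
  intro k P hP
  let contraction : Matrix ((Fin M × Fin k) × Fin N) (Fin M × Fin k) ℂ :=
    Matrix.of fun p q => if p.1 = q then 1 else 0
  let pairing : (Fin M × Fin k) × Fin N → (Fin M × Fin N) × (Fin N × Fin k) :=
    fun p => ((p.1.1, p.2), (p.2, p.1.2))
  have hfactor : ampliation (ofChoi J) k P =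
      contractionᴴ * (J ⊗ₖ P).submatrix pairing pairing * contraction := by
    ext p q
    rw [Matrix.mul_apply, Fintype.sum_prod_type_right]
    simp only [ampliation, ofChoi_apply, Matrix.of_apply, Matrix.mul_apply,
      Matrix.conjTranspose_apply, Matrix.submatrix_apply, Matrix.kroneckerMap_apply,
      contraction, pairing, mul_ite, mul_one, mul_zero, Finset.sum_ite_eq', Finset.mem_univ,
      if_true]
    rw [Finset.sum_comm]
    refine Finset.sum_congr rfl fun j _ => ?_
    rw [Fintype.sum_prod_type_right]
    refine Finset.sum_congr rfl fun i _ => ?_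
    simp [mul_comm]
  rw [hfactor]
  exact (((Matrix.nonneg_iff_posSemidef.mp hJ).kronecker hP).submatrix
    pairing).conjTranspose_mul_mul_same contraction

theorem trace_ofChoi {J : BiOp M N} (hJ : partialTrace J = 1) (X : Op N) :
    (ofChoi J X).trace = X.trace := by
  have hmarginal (i j : Fin N) : ∑ a : Fin M, J (a, i) (a, j) = (1 : Op N) i j := by
    rw [← hJ, partialTrace_apply]
  simp only [Matrix.trace, Matrix.diag, ofChoi_apply]
  rw [Finset.sum_comm]
  refine Finset.sum_congr rfl fun i _ => ?_
  rw [Finset.sum_comm]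
  simp [← Finset.mul_sum, hmarginal, Matrix.one_apply]

variable (M N) in
/-- The Choi–Jamiołkowski representations of the quantum operations `L(ℂ^N) → L(ℂ^M)`; see
`acceptanceValues_eq_image`. -/
def choiOperators : Set (BiOp M N) := {J | 0 ≤ J ∧ partialTrace J = 1}

theorem acceptanceValues_eq_image (Q : BiOp M N) :
    acceptanceValues Q = hsInner Q '' choiOperators M N := by
  ext r
  constructor
  · rintro ⟨Ψ, ⟨hcp, htp⟩, rfl⟩
    exact ⟨choi Ψ, ⟨choi_nonneg hcp, partialTrace_choi htp⟩, rfl⟩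
  · rintro ⟨J, ⟨hJ, hJtr⟩, rfl⟩
    exact ⟨ofChoi J, ⟨isCompletelyPositive_ofChoi hJ, trace_ofChoi hJtr⟩, by rw [choi_ofChoi]⟩

theorem trace_re_of_mem_choiOperators {J : BiOp M N} (hJ : J ∈ choiOperators M N) :
    J.trace.re = N := by
  rw [← trace_partialTrace, hJ.2, trace_one_re, Fintype.card_fin]

theorem isCompact_choiOperators : IsCompact (choiOperators M N) := by
  have : ProperSpace (BiOp M N) := FiniteDimensional.proper ℂ _
  have hcont : Continuous (partialTrace : BiOp M N → Op N) :=
    continuous_matrix fun i j => by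
      simp only [partialTrace_apply]
      exact continuous_finsetSum _ fun a _ => continuous_id.matrix_elem _ _
  refine Metric.isCompact_of_isClosed_isBounded
    (CStarAlgebra.isClosed_nonneg.inter (isClosed_eq hcont continuous_const))
    ((Metric.isBounded_closedBall (x := 0) (r := (N : ℝ))).subset fun J hJ => ?_)
  rw [mem_closedBall_zero_iff, ← trace_re_of_mem_choiOperators hJ]
  exact norm_le_trace_re hJ.1

section Mu

variable [NeZero M]

theorem choiOperators_nonempty : (choiOperators M N).Nonempty := by
  refine ⟨(M : ℝ)⁻¹ • ((1 : Op M) ⊗ₖ (1 : Op N)),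
    smul_nonneg (by positivity) (one_kronecker_nonneg zero_le_one), ?_⟩
  rw [partialTrace_smul, partialTrace_one_kronecker,
    inv_smul_smul₀ (Nat.cast_ne_zero.mpr (NeZero.ne M))]

theorem isGreatest_mu (Q : BiOp M N) : IsGreatest (acceptanceValues Q) (mu Q) := by
  have hcont : Continuous (hsInner Q) := by
    unfold hsInner
    fun_prop
  rw [mu, acceptanceValues_eq_image]
  exact (isCompact_choiOperators.image hcont).isGreatest_sSup (choiOperators_nonempty.image _)

theorem exists_hsInner_eq_mu (Q : BiOp M N) : ∃ J ∈ choiOperators M N, hsInner Q J = mu Q := by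
  have hmem := (isGreatest_mu Q).1
  rwa [acceptanceValues_eq_image] at hmem

theorem hsInner_le_mu (Q : BiOp M N) {J : BiOp M N} (hJ : J ∈ choiOperators M N) :
    hsInner Q J ≤ mu Q := by
  refine (isGreatest_mu Q).2 ?_
  rw [acceptanceValues_eq_image]
  exact Set.mem_image_of_mem _ hJ

theorem mu_sub_mu_le (Q R : BiOp M N) : mu Q - mu R ≤ N * ‖Q - R‖ := by
  obtain ⟨J, hJ, hQJ⟩ := exists_hsInner_eq_mu Q
  calc mu Q - mu R ≤ hsInner Q J - hsInner R J := by
        rw [hQJ]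
        exact sub_le_sub_left (hsInner_le_mu R hJ) _
    _ = ((Q - R)ᴴ * J).trace.re := by
        simp only [hsInner, Matrix.conjTranspose_sub, sub_mul, Matrix.trace_sub, Complex.sub_re]
    _ ≤ ‖(Q - R)ᴴ‖ * J.trace.re := (le_abs_self _).trans (abs_trace_mul_re_le _ hJ.1)
    _ = N * ‖Q - R‖ := by
        rw [Matrix.l2_opNorm_conjTranspose, trace_re_of_mem_choiOperators hJ, mul_comm]

theorem abs_mu_sub_mu_le (Q R : BiOp M N) : |mu Q - mu R| ≤ N * ‖Q - R‖ :=
  abs_sub_le_iff.mpr ⟨mu_sub_mu_le Q R, norm_sub_rev Q R ▸ mu_sub_mu_le R Q⟩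

theorem abs_mu_sub_mu_lt [NeZero N] {Q R : BiOp M N} {c : ℝ} (hQR : ‖Q - R‖ < c / N) :
    |mu Q - mu R| < c :=
  (abs_mu_sub_mu_le Q R).trans_lt
    ((lt_div_iff₀' (Nat.cast_pos.mpr (NeZero.pos N))).mp hQR)

end Mu

end ChoiOperators

section Program

variable {M N : ℕ} {Q : BiOp M N}

theorem hsInner_of_isHermitian {ι : Type} [Fintype ι] {A : Matrix ι ι ℂ} (hA : A.IsHermitian)
    (B : Matrix ι ι ℂ) : hsInner A B = (A * B).trace.re := by
  rw [hsInner, hA.eq]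

theorem sqrt_isHermitian (Q : BiOp M N) : (CFC.sqrt Q).IsHermitian :=
  (CFC.sqrt_nonneg Q).isSelfAdjoint.isHermitian

theorem invSqrt_isHermitian (Q : BiOp M N) : (invSqrt Q).IsHermitian :=
  (sqrt_isHermitian Q).inv

theorem sqrt_mul_invSqrt (hQ : 0 ≤ Q) (hunit : IsUnit Q) : CFC.sqrt Q * invSqrt Q = 1 :=
  Matrix.mul_nonsing_inv _
    ((Matrix.isUnit_iff_isUnit_det _).mp ((CFC.isUnit_sqrt_iff Q hQ).mpr hunit))

theorem invSqrt_mul_sqrt (hQ : 0 ≤ Q) (hunit : IsUnit Q) : invSqrt Q * CFC.sqrt Q = 1 :=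
  mul_eq_one_comm.mp (sqrt_mul_invSqrt hQ hunit)

theorem invSqrt_mul_invSqrt (hQ : 0 ≤ Q) : invSqrt Q * invSqrt Q = Q⁻¹ := by
  rw [invSqrt, ← Matrix.mul_inv_rev, CFC.sqrt_mul_sqrt_self Q hQ]

theorem invSqrt_mul_mul_invSqrt (hQ : 0 ≤ Q) (hunit : IsUnit Q) :
    invSqrt Q * Q * invSqrt Q = 1 := by
  calc invSqrt Q * Q * invSqrt Q
      = (invSqrt Q * CFC.sqrt Q) * (CFC.sqrt Q * invSqrt Q) := by
        nth_rw 2 [← CFC.sqrt_mul_sqrt_self Q hQ]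
        simp only [mul_assoc]
    _ = 1 := by rw [invSqrt_mul_sqrt hQ hunit, sqrt_mul_invSqrt hQ hunit, one_mul]

theorem phi_smul (Q : BiOp M N) (r : ℝ) (X : BiOp M N) : Phi Q (r • X) = r • Phi Q X := by
  rw [Phi, Matrix.mul_smul, Matrix.smul_mul, partialTrace_smul, Phi]

theorem phi_isHermitian (Q : BiOp M N) {X : BiOp M N} (hX : X.IsHermitian) :
    (Phi Q X).IsHermitian := by
  have hconj : (invSqrt Q * X * invSqrt Q)ᴴ = invSqrt Q * X * invSqrt Q := by
    simp only [Matrix.conjTranspose_mul, (invSqrt_isHermitian Q).eq, hX.eq, mul_assoc]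
  rw [Matrix.IsHermitian, Phi, ← partialTrace_conjTranspose, hconj]

theorem phiStar_nonneg (Q : BiOp M N) {Y : Op N} (hY : 0 ≤ Y) : 0 ≤ PhiStar Q Y :=
  (invSqrt_isHermitian Q).isSelfAdjoint.conjugate_nonneg (one_kronecker_nonneg hY)

theorem phiStar_isHermitian (Q : BiOp M N) {Y : Op N} (hY : Y.IsHermitian) :
    (PhiStar Q Y).IsHermitian := by
  simp only [PhiStar, Matrix.IsHermitian, Matrix.conjTranspose_mul, (invSqrt_isHermitian Q).eq,
    (one_kronecker_isHermitian hY).eq, mul_assoc]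

theorem phiStar_add (Q : BiOp M N) (Y Z : Op N) :
    PhiStar Q (Y + Z) = PhiStar Q Y + PhiStar Q Z := by
  simp only [PhiStar, Matrix.kronecker_add, mul_add, add_mul]

theorem phiStar_smul (Q : BiOp M N) (r : ℝ) (Y : Op N) :
    PhiStar Q (r • Y) = r • PhiStar Q Y := by
  simp only [PhiStar, Matrix.kronecker_smul, Matrix.mul_smul, Matrix.smul_mul]

theorem phiStar_mono (Q : BiOp M N) {Y Z : Op N} (hYZ : Y ≤ Z) : PhiStar Q Y ≤ PhiStar Q Z := by
  rw [← add_sub_cancel Y Z, phiStar_add]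
  exact le_add_of_nonneg_right (phiStar_nonneg Q (sub_nonneg.mpr hYZ))

theorem phiStar_one (hQ : 0 ≤ Q) : PhiStar Q 1 = Q⁻¹ := by
  rw [PhiStar, Matrix.one_kronecker_one, mul_one, invSqrt_mul_invSqrt hQ]

theorem phiStar_le_smul_one (hQ : 0 ≤ Q) {Y : Op N} {c : ℝ} (hc : 0 ≤ c) (hY : Y ≤ c • 1) :
    PhiStar Q Y ≤ (c * ‖Q⁻¹‖) • 1 := by
  calc PhiStar Q Y ≤ c • Q⁻¹ := by
        rw [← phiStar_one hQ, ← phiStar_smul]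
        exact phiStar_mono Q hY
    _ ≤ (c * ‖Q⁻¹‖) • 1 := by
        rw [mul_smul]
        exact smul_le_smul_of_nonneg_left
          (le_norm_smul_one hQ.isSelfAdjoint.isHermitian.inv) hc

theorem trace_phi_mul (Q X : BiOp M N) (Y : Op N) :
    (Phi Q X * Y).trace = (X * PhiStar Q Y).trace := by
  rw [Phi, ← partialTrace_mul_one_kronecker, trace_partialTrace, PhiStar, mul_assoc, mul_assoc,
    Matrix.trace_mul_comm]
  simp only [mul_assoc]

theorem trace_mul_invSqrt_mul_mul_invSqrt (hQ : 0 ≤ Q) (hunit : IsUnit Q) (X : BiOp M N) :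
    (Q * (invSqrt Q * X * invSqrt Q)).trace = X.trace := by
  rw [mul_assoc, ← mul_assoc Q, Matrix.trace_mul_comm, mul_assoc, ← mul_assoc _ Q,
    invSqrt_mul_mul_invSqrt hQ hunit, mul_one]

theorem PrimalFeasible.trace_le_mu [NeZero M] (hQ : 0 ≤ Q) (hunit : IsUnit Q) {X : BiOp M N}
    (hX : PrimalFeasible Q X) : X.trace.re ≤ mu Q := by
  set J : BiOp M N := invSqrt Q * X * invSqrt Q with hJ_def
  -- `J` is completed to a Choi operator by spreading the slack `𝟙 - Tr_𝒴 J` uniformly over `𝒴`.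
  set slack : BiOp M N := (M : ℝ)⁻¹ • ((1 : Op M) ⊗ₖ (1 - Phi Q X)) with hslack_def
  have hJ : 0 ≤ J := (invSqrt_isHermitian Q).isSelfAdjoint.conjugate_nonneg hX.1
  have hslack : 0 ≤ slack :=
    smul_nonneg (by positivity) (one_kronecker_nonneg (sub_nonneg.mpr hX.2))
  have hmem : J + slack ∈ choiOperators M N := by
    refine ⟨add_nonneg hJ hslack, ?_⟩
    rw [partialTrace_add, hslack_def, partialTrace_smul, partialTrace_one_kronecker,
      inv_smul_smul₀ (Nat.cast_ne_zero.mpr (NeZero.ne M))]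
    exact add_sub_cancel _ _
  calc X.trace.re = (Q * J).trace.re := by
        rw [hJ_def, trace_mul_invSqrt_mul_mul_invSqrt hQ hunit]
    _ ≤ (Q * J).trace.re + (Q * slack).trace.re :=
        le_add_of_nonneg_right (trace_mul_re_nonneg hQ hslack)
    _ = hsInner Q (J + slack) := by
        rw [hsInner_of_isHermitian hQ.isSelfAdjoint.isHermitian, mul_add, Matrix.trace_add,
          Complex.add_re]
    _ ≤ mu Q := hsInner_le_mu Q hmem

theorem dualFeasible_iff (hQ : 0 ≤ Q) (hunit : IsUnit Q) {Y : Op N} :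
    DualFeasible Q Y ↔ 0 ≤ Y ∧ Q ≤ (1 : Op M) ⊗ₖ Y := by
  refine and_congr_right fun _ => ⟨fun hY => ?_, fun hY => ?_⟩
  · have hcancel : CFC.sqrt Q * PhiStar Q Y * CFC.sqrt Q = (1 : Op M) ⊗ₖ Y := by
      rw [PhiStar, mul_assoc, mul_assoc, invSqrt_mul_sqrt hQ hunit, mul_one, ← mul_assoc,
        sqrt_mul_invSqrt hQ hunit, one_mul]
    have hconj := (sqrt_isHermitian Q).isSelfAdjoint.conjugate_le_conjugate hY
    rwa [mul_one, CFC.sqrt_mul_sqrt_self Q hQ, hcancel] at hconj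
  · have hconj := (invSqrt_isHermitian Q).isSelfAdjoint.conjugate_le_conjugate hY
    rwa [invSqrt_mul_mul_invSqrt hQ hunit] at hconj

theorem DualFeasible.mu_le_trace [NeZero M] (hQ : 0 ≤ Q) (hunit : IsUnit Q) {Y : Op N}
    (hY : DualFeasible Q Y) : mu Q ≤ Y.trace.re := by
  obtain ⟨J, hJ, hQJ⟩ := exists_hsInner_eq_mu Q
  calc mu Q = (Q * J).trace.re := by
        rw [← hQJ, hsInner_of_isHermitian hQ.isSelfAdjoint.isHermitian]
    _ ≤ (((1 : Op M) ⊗ₖ Y) * J).trace.re :=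
        trace_mul_re_mono ((dualFeasible_iff hQ hunit).mp hY).2 hJ.1
    _ = Y.trace.re := by
        rw [← trace_partialTrace, partialTrace_one_kronecker_mul, hJ.2, mul_one]

theorem trace_re_conjTranspose_mul_self {m n : Type*} [Fintype m] [Fintype n]
    (B : Matrix m n ℂ) : (Bᴴ * B).trace.re = ∑ j, ∑ i, ‖B i j‖ ^ 2 := by
  simp only [Matrix.trace, Matrix.diag, Matrix.mul_apply, Matrix.conjTranspose_apply,
    Complex.re_sum]
  refine Finset.sum_congr rfl fun j _ => Finset.sum_congr rfl fun i _ => ?_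
  rw [Complex.star_def, Complex.conj_mul', ← Complex.ofReal_pow, Complex.ofReal_re]

namespace IsInteractiveMeasurement

theorem nonneg (hQ : IsInteractiveMeasurement Q) : 0 ≤ Q := by
  obtain ⟨k, ψ, P, -, hP, -, rfl⟩ := hQ
  set B : Matrix (Fin k) (Fin N) ℂ := Matrix.of fun z i => ψ (i, z)
  have hconj := conjTranspose_mul_mul_mono hP ((1 : Op M) ⊗ₖ B)
  rwa [Matrix.mul_zero, Matrix.zero_mul, Matrix.conjTranspose_kronecker,
    Matrix.conjTranspose_one] at hconj

theorem exists_le_one_kronecker (hQ : IsInteractiveMeasurement Q) :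
    ∃ Y : Op N, 0 ≤ Y ∧ Y.trace.re = 1 ∧ Q ≤ (1 : Op M) ⊗ₖ Y := by
  obtain ⟨k, ψ, P, hψ, -, hP, rfl⟩ := hQ
  set B : Matrix (Fin k) (Fin N) ℂ := Matrix.of fun z i => ψ (i, z)
  refine ⟨Bᴴ * B, Matrix.nonneg_iff_posSemidef.mpr (Matrix.posSemidef_conjTranspose_mul_self B),
    ?_, ?_⟩
  · rw [trace_re_conjTranspose_mul_self, ← hψ, Fintype.sum_prod_type]
    rfl
  · have hconj := conjTranspose_mul_mul_mono hP ((1 : Op M) ⊗ₖ B)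
    rwa [Matrix.mul_one, Matrix.conjTranspose_kronecker, Matrix.conjTranspose_one,
      ← Matrix.mul_kronecker_mul, one_mul] at hconj

theorem exists_dualFeasible (hQ : IsInteractiveMeasurement Q) (hunit : IsUnit Q) :
    ∃ Y : Op N, DualFeasible Q Y ∧ Y.trace.re = 1 := by
  obtain ⟨Y, hY, htrace, hQY⟩ := hQ.exists_le_one_kronecker
  exact ⟨Y, (dualFeasible_iff hQ.nonneg hunit).mpr ⟨hY, hQY⟩, htrace⟩

theorem norm_le_one (hQ : IsInteractiveMeasurement Q) : ‖Q‖ ≤ 1 := by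
  obtain ⟨Y, hY, htrace, hQY⟩ := hQ.exists_le_one_kronecker
  have hY_le : Y ≤ 1 := by simpa only [htrace, one_smul] using le_trace_smul_one hY
  have hkron : (1 : Op M) ⊗ₖ Y ≤ (1 : ℝ) • 1 := by
    rw [one_smul, ← Matrix.one_kronecker_one, ← add_sub_cancel Y (1 : Op N),
      Matrix.kronecker_add]
    exact le_add_of_nonneg_right (one_kronecker_nonneg (sub_nonneg.mpr hY_le))
  exact norm_le_of_le_smul_one hQ.nonneg zero_le_one (hQY.trans hkron)

end IsInteractiveMeasurement

section NeZero

variable [NeZero M] [NeZero N]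

theorem one_le_kappa (hunit : IsUnit Q) : 1 ≤ kappa Q := by
  have hinv : Q * Q⁻¹ = 1 :=
    Matrix.mul_nonsing_inv _ ((Matrix.isUnit_iff_isUnit_det _).mp hunit)
  calc (1 : ℝ) = ‖Q * Q⁻¹‖ := by rw [hinv, CStarRing.norm_one]
    _ ≤ kappa Q := norm_mul_le _ _

theorem IsInteractiveMeasurement.one_le_norm_inv (hQ : IsInteractiveMeasurement Q)
    (hunit : IsUnit Q) : 1 ≤ ‖Q⁻¹‖ :=
  (one_le_kappa hunit).trans (mul_le_of_le_one_left (norm_nonneg _) hQ.norm_le_one)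

theorem delta_pos (hunit : IsUnit Q) {ε : ℝ} (hε : 0 < ε) : 0 < delta Q ε := by
  have hkappa := one_le_kappa hunit
  rw [delta]
  positivity

end NeZero

end Program

section Spectral

variable {ι : Type*} [Fintype ι] [DecidableEq ι]

/-- The operator `∑ f j |x_j⟩⟨x_j|` whose eigenvectors `x_j` are the columns of `U`, as a star
algebra homomorphism in the eigenvalue function `f`; see `sum_smul_ketbra`. -/
noncomputable def specOp (U : Matrix.unitaryGroup ι ℂ) : (ι → ℝ) →⋆ₐ[ℝ] Matrix ι ι ℂ where
  toFun f := U.1 * Matrix.diagonal (fun j => (f j : ℂ)) * U.1ᴴ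
  map_zero' := by simp
  map_one' := by
    have hU : U.1 * U.1ᴴ = 1 := Matrix.mem_unitaryGroup_iff.mp U.2
    simp [hU]
  map_add' f g := by
    simp [← add_mul, ← mul_add, Matrix.diagonal_add]
  map_mul' f g := by
    have hU : U.1ᴴ * U.1 = 1 := Matrix.mem_unitaryGroup_iff'.mp U.2
    simp only [Pi.mul_apply, Complex.ofReal_mul, ← Matrix.diagonal_mul_diagonal, mul_assoc]
    rw [← mul_assoc U.1ᴴ, hU, one_mul]
  commutes' r := by
    have hU : U.1 * U.1ᴴ = 1 := Matrix.mem_unitaryGroup_iff.mp U.2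
    have hdiagonal : Matrix.diagonal (fun _ => (r : ℂ)) = algebraMap ℝ (Matrix ι ι ℂ) r := rfl
    simp only [Pi.algebraMap_apply, Algebra.algebraMap_self_apply, hdiagonal,
      ← Algebra.commutes r U.1]
    rw [mul_assoc, hU, mul_one]
  map_star' f := by
    simp [Matrix.star_eq_conjTranspose, mul_assoc, Pi.star_def]

variable (U : Matrix.unitaryGroup ι ℂ)

theorem specOp_apply (f : ι → ℝ) :
    specOp U f = U.1 * Matrix.diagonal (fun j => (f j : ℂ)) * U.1ᴴ := rfl

theorem specOp_const (c : ℝ) : specOp U (fun _ => c) = c • 1 := by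
  rw [← Algebra.algebraMap_eq_smul_one]
  exact AlgHomClass.commutes (specOp U) c

theorem specOp_mono {f g : ι → ℝ} (hfg : f ≤ g) : specOp U f ≤ specOp U g :=
  OrderHomClass.mono (specOp U) hfg

theorem specOp_isHermitian (f : ι → ℝ) : (specOp U f).IsHermitian :=
  ((IsSelfAdjoint.all f).map (specOp U)).isHermitian

theorem trace_specOp (f : ι → ℝ) : (specOp U f).trace.re = ∑ j, f j := by
  have hU : U.1ᴴ * U.1 = 1 := Matrix.mem_unitaryGroup_iff'.mp U.2
  rw [specOp_apply, Matrix.trace_mul_comm, ← mul_assoc, hU, one_mul, Matrix.trace_diagonal,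
    Complex.re_sum]
  rfl

end Spectral

namespace Record

variable {M N : ℕ}

theorem sum_smul_ketbra (r : Record M N) (f : Fin N → ℝ) :
    ∑ j, (f j : ℂ) • r.ketbra j = specOp r.U f := by
  ext a b
  rw [specOp_apply, Matrix.mul_apply]
  simp only [Matrix.sum_apply, Matrix.smul_apply, ketbra, Matrix.vecMulVec_apply,
    Matrix.mul_diagonal, Matrix.conjTranspose_apply, Pi.star_apply, smul_eq_mul]
  exact Finset.sum_congr rfl fun j _ => by ring

theorem decomp_eq_specOp (r : Record M N) : r.decomp = specOp r.U r.lam := r.sum_smul_ketbra r.lam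

variable (γ : ℝ)

/-- The projection `∑_{j ∈ S} |x_j⟩⟨x_j|` onto the eigenvectors of `r.decomp` with `γ λ_j > 1`, of
which `r.Y γ` is a multiple. -/
noncomputable def proj (r : Record M N) : Op N := specOp r.U fun j => if j ∈ r.bigS γ then 1 else 0

theorem Y_eq_smul_proj (r : Record M N) : r.Y γ = (r.smallS γ)⁻¹ • r.proj γ := by
  have hsum : ∑ j ∈ r.bigS γ, r.ketbra j = r.proj γ := by
    rw [proj, ← sum_smul_ketbra, ← Finset.univ_inter (r.bigS γ), ← Finset.sum_ite_mem]
    refine Finset.sum_congr rfl fun j _ => ?_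
    rw [Finset.univ_inter]
    split_ifs <;> simp
  rw [Y, hsum, one_div]
  exact Complex.coe_smul _ _

theorem isStarProjection_proj (r : Record M N) : IsStarProjection (r.proj γ) := by
  refine ⟨?_, specOp_isHermitian _ _⟩
  rw [proj, IsIdempotentElem, ← map_mul]
  congr 1
  ext j
  simp

theorem mem_bigS_iff {r : Record M N} {j : Fin N} : j ∈ r.bigS γ ↔ 1 < γ * r.lam j := by
  simp [bigS]

theorem trace_decomp_mul_proj (r : Record M N) :
    (r.decomp * r.proj γ).trace.re = r.smallS γ := by
  rw [decomp_eq_specOp, proj, ← map_mul, trace_specOp, smallS]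
  simp [Finset.sum_ite_mem]

theorem trace_proj_le_natCast (r : Record M N) : (r.proj γ).trace.re ≤ N := by
  simpa only [trace_one_re, Fintype.card_fin] using
    trace_re_mono (r.isStarProjection_proj γ).le_one

theorem trace_proj_le_mul_smallS (r : Record M N) : (r.proj γ).trace.re ≤ γ * r.smallS γ := by
  rw [proj, trace_specOp, Finset.sum_ite_mem, Finset.univ_inter, smallS, Finset.mul_sum]
  exact Finset.sum_le_sum fun j hj => ((mem_bigS_iff γ).mp hj).le

variable {γ} (r : Record M N)

theorem Y_nonneg (hs : 0 < r.smallS γ) : 0 ≤ r.Y γ := by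
  rw [Y_eq_smul_proj]
  exact smul_nonneg (inv_nonneg.mpr hs.le) (r.isStarProjection_proj γ).nonneg

theorem Y_le (hs : 0 < r.smallS γ) : r.Y γ ≤ (r.smallS γ)⁻¹ • 1 := by
  rw [Y_eq_smul_proj]
  exact smul_le_smul_of_nonneg_left (r.isStarProjection_proj γ).le_one (inv_nonneg.mpr hs.le)

theorem trace_Y_le (hs : 0 < r.smallS γ) : (r.Y γ).trace.re ≤ γ := by
  rw [Y_eq_smul_proj, trace_smul_re, inv_mul_le_iff₀ hs, mul_comm]
  exact r.trace_proj_le_mul_smallS γ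

theorem trace_decomp_mul_Y (hs : 0 < r.smallS γ) : (r.decomp * r.Y γ).trace.re = 1 := by
  rw [Y_eq_smul_proj, Matrix.mul_smul, trace_smul_re, trace_decomp_mul_proj,
    inv_mul_cancel₀ hs.ne']

theorem lam_le_of_notMem_bigS (hγ : 0 < γ) {j : Fin N} (hj : j ∉ r.bigS γ) : r.lam j ≤ γ⁻¹ := by
  rw [mem_bigS_iff, not_lt, mul_comm] at hj
  rwa [← one_div, le_div_iff₀ hγ]

theorem one_sub_proj_mul_decomp_mul_one_sub_proj_le (hγ : 0 < γ) :
    (1 - r.proj γ) * r.decomp * (1 - r.proj γ) ≤ γ⁻¹ • 1 := by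
  rw [proj, decomp_eq_specOp, ← map_one (specOp r.U), ← map_sub, ← map_mul, ← map_mul, map_one,
    ← specOp_const r.U]
  refine specOp_mono _ fun j => ?_
  by_cases hj : j ∈ r.bigS γ
  · simpa [hj] using hγ.le
  · simpa [hj] using r.lam_le_of_notMem_bigS hγ hj

theorem trace_decomp_le (hγ : 0 < γ) : r.decomp.trace.re ≤ r.smallS γ + N / γ := by
  have hterm (j : Fin N) : r.lam j ≤ (if j ∈ r.bigS γ then r.lam j else 0) + γ⁻¹ := by
    split_ifs with hj
    · exact le_add_of_nonneg_right (inv_nonneg.mpr hγ.le)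
    · rw [zero_add]
      exact r.lam_le_of_notMem_bigS hγ hj
  calc r.decomp.trace.re = ∑ j, r.lam j := by rw [decomp_eq_specOp, trace_specOp]
    _ ≤ ∑ j, ((if j ∈ r.bigS γ then r.lam j else 0) + γ⁻¹) :=
        Finset.sum_le_sum fun j _ => hterm j
    _ = r.smallS γ + N / γ := by
        simp [Finset.sum_add_distrib, Finset.sum_ite_mem, smallS, div_eq_mul_inv]

end Record

section Compression

variable {M N : ℕ} {Q ρ : BiOp M N}

/-- The operator `√Q (𝟙 ⊗ E) Q^{-1/2} ρ Q^{-1/2} (𝟙 ⊗ E) √Q`. Compressing `ρ` in this way compresses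
`Φ(ρ)` to `E Φ(ρ) E`; see `phi_compression`. -/
noncomputable def compression (Q ρ : BiOp M N) (E : Op N) : BiOp M N :=
  CFC.sqrt Q * (((1 : Op M) ⊗ₖ E) * (invSqrt Q * ρ * invSqrt Q) * ((1 : Op M) ⊗ₖ E)) * CFC.sqrt Q

theorem compression_nonneg (Q : BiOp M N) (hρ : 0 ≤ ρ) {E : Op N} (hE : E.IsHermitian) :
    0 ≤ compression Q ρ E :=
  (sqrt_isHermitian Q).isSelfAdjoint.conjugate_nonneg
    ((one_kronecker_isHermitian hE).isSelfAdjoint.conjugate_nonneg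
      ((invSqrt_isHermitian Q).isSelfAdjoint.conjugate_nonneg hρ))

theorem phi_compression (hQ : 0 ≤ Q) (hunit : IsUnit Q) (ρ : BiOp M N) (E : Op N) :
    Phi Q (compression Q ρ E) = E * Phi Q ρ * E := by
  set inner : BiOp M N := ((1 : Op M) ⊗ₖ E) * (invSqrt Q * ρ * invSqrt Q) * ((1 : Op M) ⊗ₖ E)
    with hinner
  have hcancel : invSqrt Q * compression Q ρ E * invSqrt Q = inner := by
    calc invSqrt Q * compression Q ρ E * invSqrt Q
        = (invSqrt Q * CFC.sqrt Q) * inner * (CFC.sqrt Q * invSqrt Q) := by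
          rw [compression, ← hinner]
          simp only [mul_assoc]
      _ = inner := by
          rw [invSqrt_mul_sqrt hQ hunit, sqrt_mul_invSqrt hQ hunit, one_mul, mul_one]
  rw [Phi, hcancel, hinner, partialTrace_mul_one_kronecker, partialTrace_one_kronecker_mul, Phi]

theorem trace_compression_le (hQ : 0 ≤ Q) (hρ : 0 ≤ ρ) {E : Op N} (hE : IsStarProjection E) :
    (compression Q ρ E).trace.re ≤ ‖Q‖ * (Phi Q ρ * E).trace.re := by
  set inner : BiOp M N := ((1 : Op M) ⊗ₖ E) * (invSqrt Q * ρ * invSqrt Q) * ((1 : Op M) ⊗ₖ E)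
    with hinner_def
  have hinner : 0 ≤ inner :=
    (one_kronecker_isHermitian hE.isSelfAdjoint).isSelfAdjoint.conjugate_nonneg
      ((invSqrt_isHermitian Q).isSelfAdjoint.conjugate_nonneg hρ)
  have htrace : inner.trace = (Phi Q ρ * E).trace := by
    rw [← trace_partialTrace, hinner_def, partialTrace_mul_one_kronecker,
      partialTrace_one_kronecker_mul, Matrix.trace_mul_comm, ← mul_assoc, hE.isIdempotentElem.eq,
      Matrix.trace_mul_comm, Phi]
  calc (compression Q ρ E).trace.re = (Q * inner).trace.re := by
        rw [compression, Matrix.trace_mul_comm, ← mul_assoc, CFC.sqrt_mul_sqrt_self Q hQ]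
    _ ≤ ‖Q‖ * inner.trace.re := (le_abs_self _).trans (abs_trace_mul_re_le Q hinner)
    _ = ‖Q‖ * (Phi Q ρ * E).trace.re := by rw [htrace]

theorem one_sub_two_mul_le_trace_sub_mul_conjTranspose {m n : Type*} [Fintype m] [Fintype n]
    {A B : Matrix m n ℂ} {x : ℝ} (hx : 0 < x) (hA : (A * Aᴴ).trace.re = 1)
    (hB : (B * Bᴴ).trace.re ≤ x ^ 2) : 1 - 2 * x ≤ ((A - B) * (A - B)ᴴ).trace.re := by
  have hnonneg (C : Matrix m n ℂ) : 0 ≤ (C * Cᴴ).trace.re :=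
    trace_re_nonneg (Matrix.nonneg_iff_posSemidef.mpr (Matrix.posSemidef_self_mul_conjTranspose C))
  have hcross : (B * Aᴴ).trace.re = (A * Bᴴ).trace.re := by
    rw [← Complex.conj_re, ← Complex.star_def, ← Matrix.trace_conjTranspose,
      Matrix.conjTranspose_mul, Matrix.conjTranspose_conjTranspose]
  have hexpand (r : ℝ) : ((r • A - B) * (r • A - B)ᴴ).trace.re =
      r ^ 2 - 2 * r * (A * Bᴴ).trace.re + (B * Bᴴ).trace.re := by
    simp only [Matrix.conjTranspose_sub, Matrix.conjTranspose_smul, star_trivial, Matrix.sub_mul,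
      Matrix.mul_sub, Matrix.trace_sub, Complex.sub_re, hcross, Matrix.smul_mul, Matrix.mul_smul,
      trace_smul_re, hA]
    ring
  -- Cauchy–Schwarz `⟨A, B⟩ ≤ x` is read off from `0 ≤ ‖x A - B‖²`.
  have hcauchy_schwarz : (A * Bᴴ).trace.re ≤ x := by
    have hsq := hnonneg (x • A - B)
    rw [hexpand] at hsq
    nlinarith
  have hsq := hexpand 1
  rw [one_smul] at hsq
  linarith [hnonneg B]

/-- A form of the gentle measurement lemma. -/
theorem one_sub_two_mul_le_trace_compression (hQ : 0 ≤ Q) (hunit : IsUnit Q) (hρ : IsDensity ρ)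
    {E : Op N} (hE : E.IsHermitian) {x : ℝ} (hx : 0 < x)
    (hremoved : (compression Q ρ E).trace.re ≤ x ^ 2) :
    1 - 2 * x ≤ (compression Q ρ (1 - E)).trace.re := by
  have hconj : 0 ≤ invSqrt Q * ρ * invSqrt Q :=
    (invSqrt_isHermitian Q).isSelfAdjoint.conjugate_nonneg (Matrix.nonneg_iff_posSemidef.mpr hρ.1)
  obtain ⟨C, hC⟩ := CStarAlgebra.nonneg_iff_eq_mul_star_self.mp hconj
  rw [Matrix.star_eq_conjTranspose] at hC
  set factor : Op N → BiOp M N := fun F => CFC.sqrt Q * ((1 : Op M) ⊗ₖ F) * C with hfactor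
  have hfactor_mul {F : Op N} (hF : F.IsHermitian) :
      factor F * (factor F)ᴴ = compression Q ρ F := by
    simp only [hfactor, compression, hC, Matrix.conjTranspose_mul, (sqrt_isHermitian Q).eq,
      (one_kronecker_isHermitian hF).eq, mul_assoc]
  have hfactor_sub : factor 1 - factor E = factor (1 - E) := by
    have hkron : (1 : Op M) ⊗ₖ (1 - E) = (1 : Op M) ⊗ₖ 1 - (1 : Op M) ⊗ₖ E := by
      rw [eq_sub_iff_add_eq, ← Matrix.kronecker_add, sub_add_cancel]
    simp only [hfactor, hkron, mul_sub, sub_mul]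
  have hone : (factor 1 * (factor 1)ᴴ).trace.re = 1 := by
    rw [hfactor_mul Matrix.isHermitian_one, compression, Matrix.one_kronecker_one, one_mul, mul_one,
      Matrix.trace_mul_comm, ← mul_assoc, CFC.sqrt_mul_sqrt_self Q hQ,
      trace_mul_invSqrt_mul_mul_invSqrt hQ hunit, hρ.2, Complex.one_re]
  rw [← hfactor_mul hE] at hremoved
  rw [← hfactor_mul (Matrix.isHermitian_one.sub hE), ← hfactor_sub]
  exact one_sub_two_mul_le_trace_sub_mul_conjTranspose hx hone hremoved

end Compression

section Acceptance

variable {M N : ℕ} {Q : BiOp M N} {γ : ℝ} {r : Record M N}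

theorem phi_le_decomp_add (hρ : r.rho.IsHermitian) {h : ℝ} (herr : ‖Phi Q r.rho - r.decomp‖ ≤ h) :
    Phi Q r.rho ≤ r.decomp + h • 1 := by
  have hherm : (Phi Q r.rho - r.decomp).IsHermitian := by
    rw [r.decomp_eq_specOp]
    exact (phi_isHermitian Q hρ).sub (specOp_isHermitian _ _)
  rw [← sub_le_iff_le_add']
  exact (le_norm_smul_one hherm).trans (smul_le_smul_of_nonneg_right herr zero_le_one)

theorem trace_phi_mul_proj_le (γ : ℝ) {h : ℝ} (herr : ‖Phi Q r.rho - r.decomp‖ ≤ h) :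
    (Phi Q r.rho * r.proj γ).trace.re ≤ r.smallS γ + N * h := by
  have hproj := (r.isStarProjection_proj γ).nonneg
  have hdiff : ((Phi Q r.rho - r.decomp) * r.proj γ).trace.re ≤ N * h := by
    calc ((Phi Q r.rho - r.decomp) * r.proj γ).trace.re
        ≤ ‖Phi Q r.rho - r.decomp‖ * (r.proj γ).trace.re :=
          (le_abs_self _).trans (abs_trace_mul_re_le _ hproj)
      _ ≤ h * N := mul_le_mul herr (r.trace_proj_le_natCast γ) (trace_re_nonneg hproj)
          ((norm_nonneg _).trans herr)
      _ = N * h := mul_comm _ _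
  rwa [sub_mul, Matrix.trace_sub, Complex.sub_re, r.trace_decomp_mul_proj,
    sub_le_iff_le_add'] at hdiff

theorem one_sub_proj_mul_phi_mul_one_sub_proj_le (hγ : 0 < γ) (hρ : r.rho.IsHermitian) {h : ℝ}
    (herr : ‖Phi Q r.rho - r.decomp‖ ≤ h) :
    (1 - r.proj γ) * Phi Q r.rho * (1 - r.proj γ) ≤ (γ⁻¹ + h) • 1 := by
  set P : Op N := 1 - r.proj γ
  have hP : IsStarProjection P := (r.isStarProjection_proj γ).one_sub
  have hh : 0 ≤ h := (norm_nonneg _).trans herr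
  calc P * Phi Q r.rho * P ≤ P * (r.decomp + h • 1) * P :=
        hP.isSelfAdjoint.conjugate_le_conjugate (phi_le_decomp_add hρ herr)
    _ = P * r.decomp * P + h • P := by
        rw [mul_add, add_mul, Matrix.mul_smul, Matrix.smul_mul, mul_one,
          hP.isIdempotentElem.eq]
    _ ≤ γ⁻¹ • 1 + h • 1 := by
        gcongr
        · exact r.one_sub_proj_mul_decomp_mul_one_sub_proj_le hγ
        · exact hP.le_one
    _ = (γ⁻¹ + h) • 1 := (add_smul _ _ _).symm

theorem exists_primalFeasible_of_decomp (hQ : 0 ≤ Q) (hunit : IsUnit Q) (hγ : 0 < γ)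
    (hρ : IsDensity r.rho) {h x : ℝ} (hx : 0 < x) (herr : ‖Phi Q r.rho - r.decomp‖ ≤ h)
    (hs : ‖Q‖ * (r.smallS γ + N * h) ≤ x ^ 2) :
    ∃ X : BiOp M N, PrimalFeasible Q X ∧ γ * (1 - 2 * x) ≤ X.trace.re * (1 + γ * h) := by
  have hρ_nonneg : 0 ≤ r.rho := Matrix.nonneg_iff_posSemidef.mpr hρ.1
  have hproj := r.isStarProjection_proj γ
  have hh : 0 ≤ h := (norm_nonneg _).trans herr
  have hscale : 0 < γ⁻¹ + h := by positivity
  set X := compression Q r.rho (1 - r.proj γ) with hX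
  have hX_trace : 1 - 2 * x ≤ X.trace.re := by
    refine one_sub_two_mul_le_trace_compression hQ hunit hρ hproj.isSelfAdjoint hx ?_
    calc (compression Q r.rho (r.proj γ)).trace.re
        ≤ ‖Q‖ * (Phi Q r.rho * r.proj γ).trace.re := trace_compression_le hQ hρ_nonneg hproj
      _ ≤ ‖Q‖ * (r.smallS γ + N * h) := by
          gcongr
          exact trace_phi_mul_proj_le γ herr
      _ ≤ x ^ 2 := hs
  have hX_phi : Phi Q X ≤ (γ⁻¹ + h) • 1 := by
    rw [hX, phi_compression hQ hunit]
    exact one_sub_proj_mul_phi_mul_one_sub_proj_le hγ hρ.1.isHermitian herr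
  refine ⟨(γ⁻¹ + h)⁻¹ • X, ⟨smul_nonneg (inv_nonneg.mpr hscale.le)
    (compression_nonneg Q hρ_nonneg hproj.one_sub.isSelfAdjoint), ?_⟩, ?_⟩
  · rwa [phi_smul, inv_smul_le_iff_of_pos hscale]
  · have hfactor : (γ⁻¹ + h)⁻¹ * (1 + γ * h) = γ := by field_simp
    rw [trace_smul_re, mul_right_comm, hfactor]
    exact mul_le_mul_of_nonneg_left hX_trace hγ.le

end Acceptance

section AcceptanceBounds

variable {M N : ℕ} {Q : BiOp M N} {ε γ : ℝ} {r : Record M N}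

theorem kappa_mul_delta_le [NeZero M] [NeZero N] (hunit : IsUnit Q) (ε : ℝ) :
    kappa Q * delta Q ε ≤ ε ^ 2 / 8 := by
  have hkappa := one_le_kappa hunit
  calc kappa Q * delta Q ε = ε ^ 2 / 8 / kappa Q := by
        rw [delta]
        field_simp
    _ ≤ ε ^ 2 / 8 := div_le_self (by positivity) hkappa

theorem exists_primalFeasible_of_decomp_eq [NeZero M] [NeZero N] (hQ : 0 ≤ Q) (hunit : IsUnit Q)
    (hε : 0 < ε) (hγ : 0 < γ) (hρ : IsDensity r.rho) (hdecomp : Phi Q r.rho = r.decomp)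
    (haccept : r.AcceptTest Q ε γ) :
    ∃ X : BiOp M N, PrimalFeasible Q X ∧ (1 - ε) * γ ≤ X.trace.re := by
  have hs : ‖Q‖ * (r.smallS γ + N * 0) ≤ (ε / 2) ^ 2 := by
    calc ‖Q‖ * (r.smallS γ + N * 0) = ‖Q‖ * r.smallS γ := by rw [mul_zero, add_zero]
      _ ≤ ‖Q‖ * (delta Q ε * ‖Q⁻¹‖) := mul_le_mul_of_nonneg_left haccept (norm_nonneg Q)
      _ = kappa Q * delta Q ε := by rw [kappa]; ring
      _ ≤ (ε / 2) ^ 2 := by linarith [kappa_mul_delta_le hunit ε, sq_nonneg ε]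
  obtain ⟨X, hX, hXtrace⟩ := exists_primalFeasible_of_decomp hQ hunit hγ hρ (half_pos hε)
    (by rw [hdecomp, sub_self, norm_zero]) hs
  exact ⟨X, hX, by linarith⟩

theorem primalFeasible_zero (Q : BiOp M N) : PrimalFeasible Q 0 := by
  refine ⟨le_rfl, ?_⟩
  have hphi : Phi Q 0 = 0 := by simpa only [zero_smul] using phi_smul Q 0 0
  rw [hphi]
  exact zero_le_one

theorem one_le_norm_mul_trace_phi (hQ : 0 ≤ Q) (hunit : IsUnit Q) {ρ : BiOp M N}
    (hρ : IsDensity ρ) : 1 ≤ ‖Q‖ * (Phi Q ρ).trace.re := by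
  have hconj : 0 ≤ invSqrt Q * ρ * invSqrt Q :=
    (invSqrt_isHermitian Q).isSelfAdjoint.conjugate_nonneg (Matrix.nonneg_iff_posSemidef.mpr hρ.1)
  calc 1 = (Q * (invSqrt Q * ρ * invSqrt Q)).trace.re := by
        rw [trace_mul_invSqrt_mul_mul_invSqrt hQ hunit, hρ.2, Complex.one_re]
    _ ≤ ‖Q‖ * (invSqrt Q * ρ * invSqrt Q).trace.re :=
        (le_abs_self _).trans (abs_trace_mul_re_le Q hconj)
    _ = ‖Q‖ * (Phi Q ρ).trace.re := by rw [Phi, trace_partialTrace]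

theorem one_le_of_decomp (hQ : 0 ≤ Q) (hunit : IsUnit Q) (hγ : 0 < γ) (hρ : IsDensity r.rho)
    {h : ℝ} (herr : ‖Phi Q r.rho - r.decomp‖ ≤ h) :
    1 ≤ ‖Q‖ * (r.smallS γ + N / γ + N * h) := by
  refine (one_le_norm_mul_trace_phi hQ hunit hρ).trans
    (mul_le_mul_of_nonneg_left ?_ (norm_nonneg Q))
  calc (Phi Q r.rho).trace.re ≤ (r.decomp + h • 1).trace.re :=
        trace_re_mono (phi_le_decomp_add hρ.1.isHermitian herr)
    _ = r.decomp.trace.re + N * h := by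
        rw [Matrix.trace_add, Complex.add_re, trace_smul_re, trace_one_re, Fintype.card_fin,
          mul_comm]
    _ ≤ r.smallS γ + N / γ + N * h := by
        gcongr
        exact r.trace_decomp_le hγ

section AcceptPrecision

variable [NeZero M] [NeZero N]

theorem natCast_mul_acceptPrecision_le (hQ : IsInteractiveMeasurement Q) (hunit : IsUnit Q)
    (hε : 0 < ε) : N * (delta Q ε / (4 * N * ‖Q⁻¹‖)) ≤ delta Q ε * ‖Q⁻¹‖ / 4 := by
  have hδ := delta_pos hunit hε
  have hinv := hQ.one_le_norm_inv hunit
  have hN : (0 : ℝ) < N := Nat.cast_pos.mpr (NeZero.pos N)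
  calc N * (delta Q ε / (4 * N * ‖Q⁻¹‖)) = delta Q ε / 4 / ‖Q⁻¹‖ := by field_simp
    _ ≤ delta Q ε / 4 := div_le_self (by positivity) hinv
    _ ≤ delta Q ε * ‖Q⁻¹‖ / 4 := by
        gcongr
        exact le_mul_of_one_le_right hδ.le hinv

theorem norm_mul_smallS_add_le (hQ : IsInteractiveMeasurement Q) (hunit : IsUnit Q) (hε : 0 < ε)
    (haccept : r.AcceptTest Q ε γ) :
    ‖Q‖ * (r.smallS γ + N * (delta Q ε / (4 * N * ‖Q⁻¹‖))) ≤ (ε / 2) ^ 2 := by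
  calc ‖Q‖ * (r.smallS γ + N * (delta Q ε / (4 * N * ‖Q⁻¹‖)))
      ≤ ‖Q‖ * (delta Q ε * ‖Q⁻¹‖ + delta Q ε * ‖Q⁻¹‖ / 4) := by
        gcongr
        · exact haccept
        · exact natCast_mul_acceptPrecision_le hQ hunit hε
    _ = 5 / 4 * (kappa Q * delta Q ε) := by rw [kappa]; ring
    _ ≤ (ε / 2) ^ 2 := by linarith [kappa_mul_delta_le hunit ε, sq_nonneg ε]

/-- An acceptance with `ε < 1/2` is possible only if `γ ≤ 2 N ‖Q‖`, which turns the absolute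
decomposition error into a relative one. -/
theorem mul_acceptPrecision_le (hQ : IsInteractiveMeasurement Q) (hunit : IsUnit Q) (hε : 0 < ε)
    (hε_lt : ε < 1 / 2) (hγ : 0 < γ) (hprec : AcceptPrecision Q ε r)
    (haccept : r.AcceptTest Q ε γ) : γ * (delta Q ε / (4 * N * ‖Q⁻¹‖)) ≤ ε := by
  have hδ := delta_pos hunit hε
  have hs := norm_mul_smallS_add_le hQ hunit hε haccept
  have herror := natCast_mul_acceptPrecision_le hQ hunit hε
  have hmass := one_le_of_decomp hQ.nonneg hunit hγ hprec.1 hprec.2.le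
  set h := delta Q ε / (4 * N * ‖Q⁻¹‖)
  have : 0 ≤ h := (norm_nonneg _).trans hprec.2.le
  have hγ_le : γ ≤ 2 * (N * ‖Q‖) := by
    have hhalf : 1 / 2 ≤ N * ‖Q‖ / γ := by
      calc (1 : ℝ) / 2 ≤ 1 - (ε / 2) ^ 2 := by nlinarith
        _ ≤ ‖Q‖ * (r.smallS γ + N / γ + N * h) - ‖Q‖ * (r.smallS γ + N * h) :=
            sub_le_sub hmass hs
        _ = N * ‖Q‖ / γ := by ring
    rw [le_div_iff₀ hγ] at hhalf
    linarith
  calc γ * h ≤ 2 * (N * ‖Q‖) * h := by gcongr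
    _ = 2 * ‖Q‖ * (N * h) := by ring
    _ ≤ 2 * ‖Q‖ * (delta Q ε * ‖Q⁻¹‖ / 4) := by gcongr
    _ = kappa Q * delta Q ε / 2 := by rw [kappa]; ring
    _ ≤ ε := by nlinarith [kappa_mul_delta_le hunit ε]

theorem exists_primalFeasible_of_acceptPrecision (hQ : IsInteractiveMeasurement Q)
    (hunit : IsUnit Q) (hε : 0 < ε) (hγ : 0 < γ) (hprec : AcceptPrecision Q ε r)
    (haccept : r.AcceptTest Q ε γ) :
    ∃ X : BiOp M N, PrimalFeasible Q X ∧ (1 - 2 * ε) * γ ≤ X.trace.re := by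
  rcases le_or_gt (1 / 2) ε with hε_ge | hε_lt
  · refine ⟨0, primalFeasible_zero Q, ?_⟩
    rw [Matrix.trace_zero, Complex.zero_re]
    exact mul_nonpos_of_nonpos_of_nonneg (by linarith) hγ.le
  have hγh := mul_acceptPrecision_le hQ hunit hε hε_lt hγ hprec haccept
  have hγh_nonneg := mul_nonneg hγ.le ((norm_nonneg _).trans hprec.2.le)
  obtain ⟨X, hX, htrace⟩ := exists_primalFeasible_of_decomp hQ.nonneg hunit hγ hprec.1
    (half_pos hε) hprec.2.le (norm_mul_smallS_add_le hQ hunit hε haccept)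
  set h := delta Q ε / (4 * N * ‖Q⁻¹‖)
  have hscaled : (1 - 2 * ε) * γ * (1 + γ * h) ≤ X.trace.re * (1 + γ * h) := by
    calc (1 - 2 * ε) * γ * (1 + γ * h) = γ * ((1 - 2 * ε) * (1 + γ * h)) := by ring
      _ ≤ γ * (1 - 2 * (ε / 2)) := by
          gcongr
          nlinarith
      _ ≤ X.trace.re * (1 + γ * h) := htrace
  exact ⟨X, hX, le_of_mul_le_mul_right hscaled (by linarith)⟩

end AcceptPrecision

end AcceptanceBounds

section MultiplicativeWeights

theorem taylor_three_sub_le_exp_neg {η : ℝ} (hη : 0 ≤ η) (hη_le : η ≤ 1 / 2) :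
    1 - η + η ^ 2 / 2 - 39 / 200 * η ^ 3 ≤ Real.exp (-η) := by
  have hη_abs : |-η| = η := by rw [abs_neg, abs_of_nonneg hη]
  have htaylor := Real.exp_bound (x := -η) (hη_abs.le.trans (by linarith)) (n := 4) (by norm_num)
  rw [hη_abs, abs_le] at htaylor
  norm_num [Finset.sum_range_succ, Nat.factorial] at htaylor
  -- `39/200` exceeds `1/6 + 5/96 η`, where `5/96` is the constant of the remainder at order four.
  have hpow : η ^ 4 ≤ η ^ 3 * (1 / 2) := by
    rw [pow_succ η 3]
    gcongr
  nlinarith [htaylor.1, pow_nonneg hη 3]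

/-- To second order in `η` the right-hand side is `(1 + 2η)(1 - η + η²/12)`, so the tolerances
`η²/12` and `η²/3` are small enough to be absorbed by the factor `1 + 2η`. -/
theorem one_le_one_add_two_mul_mul_exp_neg {η : ℝ} (hη : 0 ≤ η) (hη_le : η ≤ 1 / 2) :
    1 ≤ (1 + 2 * η) * (Real.exp (-η) * (1 - η ^ 2 / 12) - η ^ 2 / 3) := by
  have hpow_three : η ^ 3 ≤ (1 / 2) ^ 3 := pow_le_pow_left₀ hη hη_le 3
  have hpow_four : η ^ 4 ≤ η ^ 3 * (1 / 2) := by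
    rw [pow_succ η 3]
    gcongr
  have hremainder : 0 ≤ η * (1 - 23 / 12 * η - 266 / 1000 * η ^ 3) :=
    mul_nonneg hη (by linarith)
  calc 1 ≤ (1 + 2 * η) * (1 - η + η ^ 2 / 12 - 133 / 1000 * η ^ 3) := by
        nlinarith [pow_nonneg hη 3]
    _ ≤ (1 + 2 * η) *
          ((1 - η + η ^ 2 / 2 - 39 / 200 * η ^ 3) * (1 - η ^ 2 / 12) - η ^ 2 / 3) := by
        refine mul_le_mul_of_nonneg_left ?_ (by linarith)
        nlinarith [pow_nonneg hη 3, pow_nonneg hη 5]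
    _ ≤ (1 + 2 * η) * (Real.exp (-η) * (1 - η ^ 2 / 12) - η ^ 2 / 3) := by
        gcongr
        · nlinarith
        · exact taylor_three_sub_le_exp_neg hη hη_le

variable {ι : Type*} [Fintype ι] [DecidableEq ι]

theorem trace_exp_add_neg_smul_le {A K : Matrix ι ι ℂ} (hA : A.IsHermitian) (hK : 0 ≤ K)
    (hK_le : K ≤ 1) {η : ℝ} (hη : 0 ≤ η) :
    (NormedSpace.exp (A + -(η • K))).trace.re ≤ (NormedSpace.exp A).trace.re -
      η * Real.exp (-η) * (NormedSpace.exp A * K).trace.re := by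
  have hexp : NormedSpace.exp (-(η • K)) ≤ 1 + Real.exp (-η) • -(η • K) :=
    exp_le_one_add_exp_neg_smul (neg_le_neg (smul_le_smul_of_nonneg_left hK_le hη))
      (neg_nonpos.mpr (smul_nonneg hη hK))
  calc (NormedSpace.exp (A + -(η • K))).trace.re
      ≤ (NormedSpace.exp A * NormedSpace.exp (-(η • K))).trace.re :=
        golden_thompson hA (hK.isSelfAdjoint.isHermitian.smul (IsSelfAdjoint.all η)).neg
    _ = (NormedSpace.exp (-(η • K)) * NormedSpace.exp A).trace.re := by
        rw [Matrix.trace_mul_comm]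
    _ ≤ ((1 + Real.exp (-η) • -(η • K)) * NormedSpace.exp A).trace.re :=
        trace_mul_re_mono hexp hA.isSelfAdjoint.exp_nonneg
    _ = (NormedSpace.exp A).trace.re -
          η * Real.exp (-η) * (NormedSpace.exp A * K).trace.re := by
        rw [add_mul, one_mul, smul_neg, smul_smul, neg_mul, Matrix.smul_mul, Matrix.trace_add,
          Matrix.trace_neg, Complex.add_re, Complex.neg_re, trace_smul_re,
          Matrix.trace_mul_comm K]
        ring

theorem matrix_multiplicative_weights (K : ℕ → Matrix ι ι ℂ) {η c : ℝ} (hη : 0 ≤ η) (T : ℕ)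
    (hK : ∀ t < T, 0 ≤ K t) (hK_le : ∀ t < T, K t ≤ 1)
    (hc : ∀ t < T, c * (NormedSpace.exp (-(η • ∑ i ∈ Finset.range t, K i))).trace.re ≤
      (NormedSpace.exp (-(η • ∑ i ∈ Finset.range t, K i)) * K t).trace.re) :
    (NormedSpace.exp (-(η • ∑ i ∈ Finset.range T, K i))).trace.re ≤
      Fintype.card ι * Real.exp (-(η * Real.exp (-η) * c * T)) := by
  induction T with
  | zero => simp
  | succ T ih =>
    have hprev := ih (fun t ht => hK t (by omega)) (fun t ht => hK_le t (by omega))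
      (fun t ht => hc t (by omega))
    have hsum : 0 ≤ ∑ i ∈ Finset.range T, K i :=
      Finset.sum_nonneg fun i hi => hK i ((Finset.mem_range.mp hi).trans T.lt_succ_self)
    have hexponent : (-(η • ∑ i ∈ Finset.range T, K i)).IsHermitian :=
      (hsum.isSelfAdjoint.isHermitian.smul (IsSelfAdjoint.all η)).neg
    have hstep :=
      trace_exp_add_neg_smul_le hexponent (hK T T.lt_succ_self) (hK_le T T.lt_succ_self) hη
    have hloss := mul_le_mul_of_nonneg_left (hc T T.lt_succ_self)
      (mul_nonneg hη (Real.exp_pos (-η)).le)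
    have hw := trace_re_nonneg hexponent.isSelfAdjoint.exp_nonneg
    rw [Finset.sum_range_succ, smul_add, neg_add]
    set w := (NormedSpace.exp (-(η • ∑ i ∈ Finset.range T, K i))).trace.re
    calc _ ≤ w - η * Real.exp (-η) * (c * w) := by linarith
      _ = w * (-(η * Real.exp (-η) * c) + 1) := by ring
      _ ≤ w * Real.exp (-(η * Real.exp (-η) * c)) :=
          mul_le_mul_of_nonneg_left (Real.add_one_le_exp _) hw
      _ ≤ (Fintype.card ι * Real.exp (-(η * Real.exp (-η) * c * T))) *
            Real.exp (-(η * Real.exp (-η) * c)) :=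
          mul_le_mul_of_nonneg_right hprev (Real.exp_pos _).le
      _ = Fintype.card ι * Real.exp (-(η * Real.exp (-η) * c * (T + 1 : ℕ))) := by
          rw [mul_assoc, ← Real.exp_add]
          push_cast
          ring_nf

end MultiplicativeWeights

section Weights

variable {M N : ℕ} {Q : BiOp M N} {ε γ : ℝ} {e : ℕ → Record M N}

theorem phiStar_sum (Q : BiOp M N) {κ : Type*} (s : Finset κ) (Y : κ → Op N) :
    PhiStar Q (∑ i ∈ s, Y i) = ∑ i ∈ s, PhiStar Q (Y i) :=
  map_sum (AddMonoidHom.mk' (PhiStar Q) (phiStar_add Q)) Y s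

/-- The loss operator `δ Φ*(Y_t)` that iteration `t` feeds into the multiplicative weights update;
it satisfies `0 ≤ loss ≤ 𝟙` unless the iteration accepts. -/
noncomputable def loss (Q : BiOp M N) (ε γ : ℝ) (e : ℕ → Record M N) (t : ℕ) : BiOp M N :=
  delta Q ε • PhiStar Q ((e t).Y γ)

theorem sum_loss (Q : BiOp M N) (ε γ : ℝ) (e : ℕ → Record M N) (t : ℕ) :
    ∑ i ∈ Finset.range t, loss Q ε γ e i =
      delta Q ε • PhiStar Q (∑ i ∈ Finset.range t, (e i).Y γ) := by
  simp only [loss, phiStar_sum, Finset.smul_sum]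

theorem bigW_eq_exp_neg_sum_loss (Q : BiOp M N) (ε γ : ℝ) (e : ℕ → Record M N) (t : ℕ) :
    bigW Q ε γ e t =
      NormedSpace.exp (-((ε * γ / 2) • ∑ i ∈ Finset.range t, loss Q ε γ e i)) := by
  rw [bigW, sum_loss, Complex.coe_smul, smul_smul, ← neg_smul, div_mul_eq_mul_div]

theorem Record.Y_isHermitian (γ : ℝ) (r : Record M N) : (r.Y γ).IsHermitian := by
  rw [r.Y_eq_smul_proj]
  exact (specOp_isHermitian _ _).smul (IsSelfAdjoint.all _)

theorem sum_Y_isHermitian (γ : ℝ) (e : ℕ → Record M N) (t : ℕ) :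
    (∑ i ∈ Finset.range t, (e i).Y γ).IsHermitian := by
  rw [Matrix.IsHermitian, Matrix.conjTranspose_sum]
  exact Finset.sum_congr rfl fun i _ => (e i).Y_isHermitian γ

theorem neg_sum_loss_isHermitian (Q : BiOp M N) (ε γ : ℝ) (e : ℕ → Record M N) (t : ℕ) :
    (-((ε * γ / 2) • ∑ i ∈ Finset.range t, loss Q ε γ e i)).IsHermitian := by
  rw [sum_loss]
  exact (((phiStar_isHermitian Q (sum_Y_isHermitian γ e t)).smul (IsSelfAdjoint.all _)).smul
    (IsSelfAdjoint.all _)).neg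

theorem bigW_nonneg (Q : BiOp M N) (ε γ : ℝ) (e : ℕ → Record M N) (t : ℕ) :
    0 ≤ bigW Q ε γ e t := by
  rw [bigW_eq_exp_neg_sum_loss]
  exact (neg_sum_loss_isHermitian Q ε γ e t).isSelfAdjoint.exp_nonneg

theorem trace_bigW_pos [NeZero M] [NeZero N] (Q : BiOp M N) (ε γ : ℝ) (e : ℕ → Record M N)
    (t : ℕ) : 0 < (bigW Q ε γ e t).trace.re := by
  have hposDef : (bigW Q ε γ e t).PosDef :=
    (Matrix.nonneg_iff_posSemidef.mp (bigW_nonneg Q ε γ e t)).posDef_iff_isUnit.mpr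
      (Matrix.isUnit_exp _)
  exact (Complex.pos_iff.mp hposDef.trace_pos).1

theorem normalize_eq_smul {W : BiOp M N} (hW : W.IsHermitian) :
    normalize W = (W.trace.re)⁻¹ • W := by
  have htrace : (W.trace.re : ℂ) = W.trace := by
    rw [← Complex.conj_eq_iff_re, ← Complex.star_def, ← Matrix.trace_conjTranspose, hW.eq]
  rw [normalize, ← htrace, ← Complex.ofReal_inv, Complex.coe_smul, Complex.ofReal_re]

theorem normalize_isHermitian {W : BiOp M N} (hW : W.IsHermitian) : (normalize W).IsHermitian := by
  rw [normalize_eq_smul hW]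
  exact hW.smul (IsSelfAdjoint.all _)

theorem isDensity_normalize {W : BiOp M N} (hW : 0 ≤ W) (htrace : 0 < W.trace.re) :
    IsDensity (normalize W) := by
  refine ⟨?_, ?_⟩
  · rw [normalize_eq_smul hW.isSelfAdjoint.isHermitian]
    exact Matrix.nonneg_iff_posSemidef.mp (smul_nonneg (inv_nonneg.mpr htrace.le) hW)
  · have htrace_ne : W.trace ≠ 0 := fun hzero => htrace.ne' (by rw [hzero, Complex.zero_re])
    rw [normalize, Matrix.trace_smul, smul_eq_mul, inv_mul_cancel₀ htrace_ne]

theorem hsInner_normalize {W : BiOp M N} (hW : W.IsHermitian) (B : BiOp M N) :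
    hsInner (normalize W) B = (W * B).trace.re / W.trace.re := by
  rw [hsInner_of_isHermitian (normalize_isHermitian hW), normalize_eq_smul hW, Matrix.smul_mul,
    trace_smul_re, inv_mul_eq_div]

section Loss

variable [NeZero M] [NeZero N]

theorem smallS_pos (hunit : IsUnit Q) (hε : 0 < ε) {r : Record M N}
    (hr : ¬ r.AcceptTest Q ε γ) : 0 < r.smallS γ :=
  (mul_nonneg (delta_pos hunit hε).le (norm_nonneg _)).trans_lt (not_le.mp hr)

theorem loss_nonneg (hunit : IsUnit Q) (hε : 0 < ε) {t : ℕ}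
    (ht : ¬ (e t).AcceptTest Q ε γ) : 0 ≤ loss Q ε γ e t :=
  smul_nonneg (delta_pos hunit hε).le (phiStar_nonneg Q ((e t).Y_nonneg (smallS_pos hunit hε ht)))

theorem loss_le_one (hQ : 0 ≤ Q) (hunit : IsUnit Q) (hε : 0 < ε) {t : ℕ}
    (ht : ¬ (e t).AcceptTest Q ε γ) : loss Q ε γ e t ≤ 1 := by
  have hs := smallS_pos hunit hε ht
  have hscale : delta Q ε * ((e t).smallS γ)⁻¹ * ‖Q⁻¹‖ ≤ 1 := by
    rw [mul_right_comm, mul_inv_le_iff₀ hs, one_mul]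
    exact (not_le.mp ht).le
  calc loss Q ε γ e t ≤ delta Q ε • ((((e t).smallS γ)⁻¹ * ‖Q⁻¹‖) • (1 : BiOp M N)) :=
        smul_le_smul_of_nonneg_left
          (phiStar_le_smul_one hQ (inv_nonneg.mpr hs.le) ((e t).Y_le hs)) (delta_pos hunit hε).le
    _ = (delta Q ε * ((e t).smallS γ)⁻¹ * ‖Q⁻¹‖) • 1 := by rw [smul_smul, mul_assoc]
    _ ≤ 1 := smul_le_of_le_one_left zero_le_one hscale

theorem trace_bigW_le (hQ : 0 ≤ Q) (hunit : IsUnit Q) (hε : 0 < ε) (hγ : 0 < γ) {T : ℕ}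
    (hcontinue : ∀ t < T, ¬ (e t).AcceptTest Q ε γ)
    (hprec : ∀ t < T, RejectPrecision Q ε γ e t) :
    (bigW Q ε γ e T).trace.re ≤ N * M * Real.exp (-(ε * γ / 2 * Real.exp (-(ε * γ / 2)) *
      (delta Q ε * (1 - (ε * γ / 2) ^ 2 / 12)) * T)) := by
  rw [bigW_eq_exp_neg_sum_loss]
  refine (matrix_multiplicative_weights (loss Q ε γ e) (c := delta Q ε * (1 - (ε * γ / 2) ^ 2 / 12))
    (by positivity) T
    (fun t ht => loss_nonneg hunit hε (hcontinue t ht))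
    (fun t ht => loss_le_one hQ hunit hε (hcontinue t ht)) fun t ht => ?_).trans_eq ?_
  · have hprogress := hprec t ht
    rw [RejectPrecision, hsInner_normalize (bigW_nonneg Q ε γ e t).isSelfAdjoint.isHermitian,
      gt_iff_lt, lt_div_iff₀ (trace_bigW_pos Q ε γ e t)] at hprogress
    rw [← bigW_eq_exp_neg_sum_loss, loss, Matrix.mul_smul, trace_smul_re, mul_assoc]
    exact mul_le_mul_of_nonneg_left hprogress.le (delta_pos hunit hε).le
  · rw [Fintype.card_prod, Fintype.card_fin, Fintype.card_fin, Nat.cast_mul, mul_comm (M : ℝ)]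

end Loss

end Weights

section Rejection

variable {M N : ℕ} {Q : BiOp M N} {ε γ : ℝ} {e : ℕ → Record M N}

theorem smul_one_le_phiStar_sum_of_trace_bigW_le (hηδ : 0 < ε * γ / 2 * delta Q ε) {T : ℕ} {x : ℝ}
    (htrace : (bigW Q ε γ e T).trace.re ≤ Real.exp (-(ε * γ / 2 * delta Q ε * x))) :
    x • (1 : BiOp M N) ≤ PhiStar Q (∑ i ∈ Finset.range T, (e i).Y γ) := by
  rw [bigW_eq_exp_neg_sum_loss] at htrace
  have hexponent := le_smul_one_of_trace_exp_le (neg_sum_loss_isHermitian Q ε γ e T) htrace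
  rwa [sum_loss, smul_smul, neg_smul, neg_le_neg_iff, mul_smul,
    smul_le_smul_iff_of_pos_left hηδ] at hexponent

theorem log_le_of_bigT (hε : 0 < ε) (hγ : 0 < γ) (hδ : 0 < delta Q ε) :
    Real.log (N * M) ≤
      ε * γ / 2 * delta Q ε * (bigT Q ε γ * ((ε * γ / 2) ^ 2 / 3)) := by
  have hceil : 24 * Real.log (N * M) / (ε ^ 3 * γ ^ 3 * delta Q ε) ≤ bigT Q ε γ := Nat.le_ceil _
  rw [div_le_iff₀ (by positivity)] at hceil
  linarith

theorem exists_dualFeasible_of_smul_one_le {T : ℕ} (hT : 0 < T)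
    (hs : ∀ t < T, 0 < (e t).smallS γ) {c f : ℝ} (hc : 0 ≤ c) (hcf : 1 ≤ c * f)
    (hf : (T * f) • (1 : BiOp M N) ≤ PhiStar Q (∑ t ∈ Finset.range T, (e t).Y γ)) :
    ∃ Y : Op N, DualFeasible Q Y ∧ Y.trace.re ≤ c * γ := by
  have hT_ne : (T : ℝ) ≠ 0 := Nat.cast_ne_zero.mpr hT.ne'
  have hcT : 0 ≤ c / T := by positivity
  have hsum_nonneg : 0 ≤ ∑ t ∈ Finset.range T, (e t).Y γ :=
    Finset.sum_nonneg fun t ht => (e t).Y_nonneg (hs t (Finset.mem_range.mp ht))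
  refine ⟨(c / T) • ∑ t ∈ Finset.range T, (e t).Y γ, ⟨smul_nonneg hcT hsum_nonneg, ?_⟩, ?_⟩
  · calc (1 : BiOp M N) ≤ (c * f) • 1 := le_smul_of_one_le_left zero_le_one hcf
      _ = (c / T) • (T * f) • 1 := by
          rw [smul_smul, ← mul_assoc, div_mul_cancel₀ c hT_ne]
      _ ≤ (c / T) • PhiStar Q (∑ t ∈ Finset.range T, (e t).Y γ) :=
          smul_le_smul_of_nonneg_left hf hcT
      _ = PhiStar Q ((c / T) • ∑ t ∈ Finset.range T, (e t).Y γ) := (phiStar_smul Q _ _).symm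
  · calc ((c / T) • ∑ t ∈ Finset.range T, (e t).Y γ).trace.re
        = c / T * ∑ t ∈ Finset.range T, ((e t).Y γ).trace.re := by
          rw [trace_smul_re, Matrix.trace_sum, Complex.re_sum]
      _ ≤ c / T * ∑ _t ∈ Finset.range T, γ := by
          gcongr with t ht
          exact (e t).trace_Y_le (hs t (Finset.mem_range.mp ht))
      _ = c * γ := by
          rw [Finset.sum_const, Finset.card_range, nsmul_eq_mul, ← mul_assoc,
            div_mul_cancel₀ c hT_ne]

variable [NeZero M] [NeZero N]

theorem smul_one_le_phiStar_sum_of_rejects (hQ : 0 ≤ Q) (hunit : IsUnit Q) (hε : 0 < ε)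
    (hγ : 0 < γ) (hrej : Rejects Q ε γ e)
    (hprec : ∀ t < bigT Q ε γ, RejectPrecision Q ε γ e t) :
    (bigT Q ε γ * (Real.exp (-(ε * γ / 2)) * (1 - (ε * γ / 2) ^ 2 / 12) - (ε * γ / 2) ^ 2 / 3)) •
      (1 : BiOp M N) ≤ PhiStar Q (∑ t ∈ Finset.range (bigT Q ε γ), (e t).Y γ) := by
  have hδ := delta_pos hunit hε
  have hlog := log_le_of_bigT hε hγ hδ
  have hNM : (0 : ℝ) < N * M := by
    exact_mod_cast Nat.mul_pos (NeZero.pos N) (NeZero.pos M)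
  refine smul_one_le_phiStar_sum_of_trace_bigW_le (by positivity)
    ((trace_bigW_le hQ hunit hε hγ hrej hprec).trans ?_)
  rw [← Real.exp_log hNM, ← Real.exp_add, Real.exp_le_exp]
  linarith

theorem bigT_pos (hMN : 2 ≤ N * M) (hunit : IsUnit Q) (hε : 0 < ε) (hγ : 0 < γ) :
    0 < bigT Q ε γ := by
  have hδ := delta_pos hunit hε
  have hlog : 0 < Real.log (N * M) := Real.log_pos (by exact_mod_cast hMN)
  exact Nat.ceil_pos.mpr (by positivity)

theorem exists_dualFeasible_of_rejects (hMN : 2 ≤ N * M) (hQ : IsInteractiveMeasurement Q)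
    (hunit : IsUnit Q) (hε : 0 < ε) (hγ : 0 < γ) (hrej : Rejects Q ε γ e)
    (hprec : ∀ t < bigT Q ε γ, RejectPrecision Q ε γ e t) :
    ∃ Y : Op N, DualFeasible Q Y ∧ Y.trace.re ≤ (1 + ε) * γ := by
  rcases le_or_gt 1 ((1 + ε) * γ) with hlarge | hsmall
  · obtain ⟨Y, hY, htrace⟩ := hQ.exists_dualFeasible hunit
    exact ⟨Y, hY, htrace.trans_le hlarge⟩
  refine exists_dualFeasible_of_smul_one_le (bigT_pos hMN hunit hε hγ)
    (fun t ht => smallS_pos hunit hε (hrej t ht)) (by positivity) ?_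
    (smul_one_le_phiStar_sum_of_rejects hQ.nonneg hunit hε hγ hrej hprec)
  have hη_le : ε * γ / 2 ≤ 1 / 2 := by linarith
  have hη_le_ε : 2 * (ε * γ / 2) ≤ ε := by nlinarith
  have hbound := one_le_one_add_two_mul_mul_exp_neg (by positivity) hη_le
  refine hbound.trans (mul_le_mul_of_nonneg_right (by linarith) ?_)
  exact (pos_of_mul_pos_right (one_pos.trans_le hbound) (by positivity)).le

end Rejection

section Runs

variable {M N : ℕ} {Q : BiOp M N} {ε γ : ℝ} {e : ℕ → Record M N}

theorem iterations_le_bigT (Q : BiOp M N) (ε γ : ℝ) (e : ℕ → Record M N) :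
    iterations Q ε γ e ≤ bigT Q ε γ := by
  have hsubset : {t | Reached Q ε γ e t} ⊆ Set.Iio (bigT Q ε γ) := fun t ht => ht.1
  simpa [iterations] using Set.ncard_le_ncard hsubset (Set.finite_Iio _)

theorem accepts_or_rejects (Q : BiOp M N) (ε γ : ℝ) (e : ℕ → Record M N) :
    (∃ t, AcceptsAt Q ε γ e t) ∨ Rejects Q ε γ e := by
  classical
  refine or_iff_not_imp_right.mpr fun hrej => ?_
  have haccept : ∃ t, t < bigT Q ε γ ∧ (e t).AcceptTest Q ε γ := by
    simpa only [Rejects, not_forall, not_not, exists_prop] using hrej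
  obtain ⟨hlt, htest⟩ := Nat.find_spec haccept
  exact ⟨Nat.find haccept,
    ⟨hlt, fun i hi hi_test => Nat.find_min haccept hi ⟨hi.trans hlt, hi_test⟩⟩, htest⟩

theorem Rejects.reached (hrej : Rejects Q ε γ e) {t : ℕ} (ht : t < bigT Q ε γ) :
    Reached Q ε γ e t :=
  ⟨ht, fun i hi => hrej i (hi.trans ht)⟩

theorem delta_le [NeZero M] [NeZero N] (hunit : IsUnit Q) (ε : ℝ) : delta Q ε ≤ ε ^ 2 / 8 := by
  have hkappa := one_le_kappa hunit
  rw [delta, ← div_div]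
  exact div_le_self (by positivity) (one_le_pow₀ hkappa)

theorem bigT_le [NeZero M] [NeZero N] (hMN : 2 ≤ N * M) (hunit : IsUnit Q) (hε : 0 < ε)
    (hγ : 0 < γ) (hε_le : ε ≤ 1) (hγ_le : γ ≤ 1) :
    (bigT Q ε γ : ℝ) ≤ 25 * (Real.log ((N : ℝ) * M) / (ε ^ 3 * γ ^ 3 * delta Q ε)) := by
  have hδ := delta_pos hunit hε
  have hlog : 1 / 8 ≤ Real.log ((N : ℝ) * M) := by
    calc 1 / 8 ≤ Real.log 2 := by linarith [Real.log_two_gt_d9]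
      _ ≤ Real.log ((N : ℝ) * M) := Real.log_le_log two_pos (by exact_mod_cast hMN)
  have hdenominator : ε ^ 3 * γ ^ 3 * delta Q ε ≤ 1 / 8 := by
    calc ε ^ 3 * γ ^ 3 * delta Q ε ≤ 1 * 1 * (ε ^ 2 / 8) := by
          gcongr
          · exact pow_le_one₀ hε.le hε_le
          · exact pow_le_one₀ hγ.le hγ_le
          · exact delta_le hunit ε
      _ ≤ 1 / 8 := by linarith [pow_le_one₀ hε.le hε_le (n := 2)]
  have hratio : 1 ≤ Real.log ((N : ℝ) * M) / (ε ^ 3 * γ ^ 3 * delta Q ε) := by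
    rw [one_le_div (by positivity)]
    exact hdenominator.trans hlog
  calc (bigT Q ε γ : ℝ)
      ≤ 24 * Real.log ((N : ℝ) * M) / (ε ^ 3 * γ ^ 3 * delta Q ε) + 1 :=
        (Nat.ceil_lt_add_one (by positivity)).le
    _ ≤ 25 * (Real.log ((N : ℝ) * M) / (ε ^ 3 * γ ^ 3 * delta Q ε)) := by
        rw [mul_div_assoc]
        linarith

end Runs

section ExactRuns

variable {M N : ℕ} {Q : BiOp M N} {ε γ : ℝ} {e : ℕ → Record M N}

theorem exists_record_of_isHermitian (Q : BiOp M N) {ρ : BiOp M N} (hρ : ρ.IsHermitian) :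
    ∃ r : Record M N, r.rho = ρ ∧ Phi Q r.rho = r.decomp := by
  have hphi := phi_isHermitian Q hρ
  refine ⟨⟨ρ, hphi.eigenvectorUnitary, hphi.eigenvalues⟩, rfl, ?_⟩
  rw [Record.decomp_eq_specOp, specOp_apply]
  exact hphi.spectral_theorem

theorem exists_exactRun (Q : BiOp M N) (ε γ : ℝ) : ∃ e : ℕ → Record M N, IsExactRun Q ε γ e := by
  let W (S : Op N) : BiOp M N :=
    NormedSpace.exp (((-(ε * γ * delta Q ε / 2) : ℝ) : ℂ) • PhiStar Q S)
  have hW (S : Op N) (hS : S.IsHermitian) : (normalize (W S)).IsHermitian := by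
    refine normalize_isHermitian (Matrix.IsHermitian.exp ?_)
    rw [Complex.coe_smul]
    exact (phiStar_isHermitian Q hS).smul (IsSelfAdjoint.all _)
  have : Nonempty (Record M N) := ⟨⟨0, 1, 0⟩⟩
  choose! next hnext_rho hnext_phi using fun S hS => exists_record_of_isHermitian Q (hW S hS)
  let S : ℕ → Op N := Nat.rec 0 fun _ S => S + (next S).Y γ
  have hS (t : ℕ) : ∑ i ∈ Finset.range t, (next (S i)).Y γ = S t := by
    induction t with
    | zero => rfl
    | succ t ih => rw [Finset.sum_range_succ, ih]
  have hS_isHermitian (t : ℕ) : (S t).IsHermitian := by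
    rw [← hS]
    exact sum_Y_isHermitian γ (fun i => next (S i)) t
  refine ⟨fun t => next (S t), fun t _ => ⟨?_, hnext_phi _ (hS_isHermitian t)⟩⟩
  rw [hnext_rho _ (hS_isHermitian t), bigW, hS]

theorem one_sub_le_hsInner_phiStar_Y {r : Record M N} (hρ : r.rho.IsHermitian)
    (hs : 0 < r.smallS γ) {τ : ℝ} (herr : ‖Phi Q r.rho - r.decomp‖ ≤ τ) :
    1 - τ * γ ≤ hsInner r.rho (PhiStar Q (r.Y γ)) := by
  have hY := r.Y_nonneg hs
  have hdiff : -((Phi Q r.rho - r.decomp) * r.Y γ).trace.re ≤ τ * γ := by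
    calc -((Phi Q r.rho - r.decomp) * r.Y γ).trace.re
        ≤ ‖Phi Q r.rho - r.decomp‖ * (r.Y γ).trace.re :=
          (neg_le_abs _).trans (abs_trace_mul_re_le _ hY)
      _ ≤ τ * γ := mul_le_mul herr (r.trace_Y_le hs) (trace_re_nonneg hY)
          ((norm_nonneg _).trans herr)
  rw [sub_mul, Matrix.trace_sub, Complex.sub_re, r.trace_decomp_mul_Y hs] at hdiff
  rw [hsInner_of_isHermitian hρ, ← trace_phi_mul]
  linarith

variable [NeZero M] [NeZero N]

theorem IsExactRun.isDensity (he : IsExactRun Q ε γ e) {t : ℕ} (ht : Reached Q ε γ e t) :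
    IsDensity (e t).rho := by
  rw [(he t ht).1]
  exact isDensity_normalize (bigW_nonneg Q ε γ e t) (trace_bigW_pos Q ε γ e t)

theorem IsExactRun.rejectPrecision (he : IsExactRun Q ε γ e) (hunit : IsUnit Q) (hε : 0 < ε)
    (hγ : 0 < γ) {t : ℕ} (ht : Reached Q ε γ e t) (hcontinue : ¬ (e t).AcceptTest Q ε γ) :
    RejectPrecision Q ε γ e t := by
  have hexact := one_sub_le_hsInner_phiStar_Y (he.isDensity ht).1.isHermitian
    (smallS_pos hunit hε hcontinue) (by rw [(he t ht).2, sub_self, norm_zero])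
  rw [RejectPrecision, ← (he t ht).1]
  have hη : 0 < (ε * γ / 2) ^ 2 / 12 := by positivity
  linarith

theorem IsExactRun.exists_primalFeasible (he : IsExactRun Q ε γ e) (hQ : 0 ≤ Q)
    (hunit : IsUnit Q) (hε : 0 < ε) (hγ : 0 < γ) {t : ℕ} (ht : AcceptsAt Q ε γ e t) :
    ∃ X : BiOp M N, PrimalFeasible Q X ∧ (1 - ε) * γ ≤ X.trace.re :=
  exists_primalFeasible_of_decomp_eq hQ hunit hε hγ (he.isDensity ht.1) (he t ht.1).2 ht.2

theorem IsExactRun.exists_dualFeasible (he : IsExactRun Q ε γ e) (hMN : 2 ≤ N * M)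
    (hQ : IsInteractiveMeasurement Q) (hunit : IsUnit Q) (hε : 0 < ε) (hγ : 0 < γ)
    (hrej : Rejects Q ε γ e) : ∃ Y : Op N, DualFeasible Q Y ∧ Y.trace.re ≤ (1 + ε) * γ :=
  exists_dualFeasible_of_rejects hMN hQ hunit hε hγ hrej fun t ht =>
    he.rejectPrecision hunit hε hγ (hrej.reached ht) (hrej t ht)

end ExactRuns

section ApproximateRuns

theorem div_sub_div_le_two_mul_div {a b c d E : ℝ} (ha : 0 ≤ a) (hb : 0 < b) (hab : a ≤ b)
    (hc : 0 < c) (hE : 0 ≤ E) (had : a - d ≤ E) (hcb : c - b ≤ E) :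
    a / b - d / c ≤ 2 * E / c := by
  have hscaled : a / b * (c - b) ≤ E := by
    calc a / b * (c - b) ≤ a / b * E := by gcongr
      _ ≤ E := mul_le_of_le_one_left hE ((div_le_one hb).mpr hab)
  calc a / b - d / c = ((a - d) + a / b * (c - b)) / c := by
        field_simp
        ring
    _ ≤ 2 * E / c := by
        gcongr
        linarith

section Perturbation

variable {ι : Type*} [Fintype ι] [DecidableEq ι] {V W : Matrix ι ι ℂ} {w τ : ℝ}

theorem smul_one_le_of_norm_sub_le (hW : w • 1 ≤ W) (hVW : (V - W).IsHermitian)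
    (hdist : ‖V - W‖ ≤ τ) : (w - τ) • 1 ≤ V := by
  have hWV : W - V ≤ τ • 1 := by
    refine (le_norm_smul_one (neg_sub V W ▸ hVW.neg)).trans ?_
    rw [norm_sub_rev]
    exact smul_le_smul_of_nonneg_right hdist zero_le_one
  calc (w - τ) • (1 : Matrix ι ι ℂ) = w • 1 - τ • 1 := sub_smul _ _ _
    _ ≤ W - (W - V) := sub_le_sub hW hWV
    _ = V := sub_sub_cancel W V

theorem card_mul_le_trace (hW : w • 1 ≤ W) : Fintype.card ι * w ≤ W.trace.re := by
  simpa only [trace_smul_re, trace_one_re, mul_comm w] using trace_re_mono hW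

variable [Nonempty ι]

theorem trace_re_pos_of_smul_one_le (hw : 0 < w) (hW : w • 1 ≤ W) : 0 < W.trace.re :=
  (mul_pos (Nat.cast_pos.mpr Fintype.card_pos) hw).trans_le (card_mul_le_trace hW)

theorem trace_mul_div_trace_sub_le {K : Matrix ι ι ℂ} (hw : 0 < w) (hW : w • 1 ≤ W)
    (hV : 0 ≤ V) (hV_trace : 0 < V.trace.re) (hdist : ‖V - W‖ ≤ τ) (hK : 0 ≤ K) (hK_le : K ≤ 1) :
    (V * K).trace.re / V.trace.re - (W * K).trace.re / W.trace.re ≤ 2 * τ / w := by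
  have hτ : 0 ≤ τ := (norm_nonneg _).trans hdist
  have hW_trace := trace_re_pos_of_smul_one_le hw hW
  have hVK_le : (V * K).trace.re ≤ V.trace.re := by
    simpa only [Matrix.trace_mul_comm K, one_mul] using trace_mul_re_mono hK_le hV
  have hK_trace : K.trace.re ≤ Fintype.card ι := by
    simpa only [trace_one_re] using trace_re_mono hK_le
  have hnumerator : (V * K).trace.re - (W * K).trace.re ≤ Fintype.card ι * τ := by
    calc (V * K).trace.re - (W * K).trace.re = ((V - W) * K).trace.re := by
          rw [sub_mul, Matrix.trace_sub, Complex.sub_re]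
      _ ≤ ‖V - W‖ * K.trace.re := (le_abs_self _).trans (abs_trace_mul_re_le _ hK)
      _ ≤ τ * Fintype.card ι := mul_le_mul hdist hK_trace (trace_re_nonneg hK) hτ
      _ = Fintype.card ι * τ := mul_comm _ _
  have hdenominator : W.trace.re - V.trace.re ≤ Fintype.card ι * τ := by
    calc W.trace.re - V.trace.re = -(V - W).trace.re := by
          rw [Matrix.trace_sub, Complex.sub_re, neg_sub]
      _ ≤ Fintype.card ι * ‖V - W‖ := (neg_le_abs _).trans (abs_trace_re_le _)
      _ ≤ Fintype.card ι * τ := by gcongr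
  refine (div_sub_div_le_two_mul_div (trace_mul_re_nonneg hV hK) hV_trace hVK_le hW_trace
    (by positivity) hnumerator hdenominator).trans ?_
  rw [div_le_div_iff₀ hW_trace hw]
  calc 2 * (Fintype.card ι * τ) * w = 2 * τ * (Fintype.card ι * w) := by ring
    _ ≤ 2 * τ * W.trace.re := by
        gcongr
        exact card_mul_le_trace hW

end Perturbation

variable {M N : ℕ} [NeZero M] [NeZero N] {Q : BiOp M N} {ε γ : ℝ} {e : ℕ → Record M N}

theorem exp_smul_one_le_bigW (hQ : 0 ≤ Q) (hunit : IsUnit Q) (hε : 0 < ε) (hγ : 0 < γ) {t : ℕ}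
    (ht : Reached Q ε γ e t) :
    Real.exp (-(ε * γ / 2 * bigT Q ε γ)) • 1 ≤ bigW Q ε γ e t := by
  have hsum : ∑ i ∈ Finset.range t, loss Q ε γ e i ≤ (bigT Q ε γ : ℝ) • 1 := by
    calc ∑ i ∈ Finset.range t, loss Q ε γ e i ≤ ∑ _i ∈ Finset.range t, (1 : BiOp M N) :=
          Finset.sum_le_sum fun i hi =>
            loss_le_one hQ hunit hε (ht.2 i (Finset.mem_range.mp hi))
      _ = (t : ℝ) • 1 := by rw [Finset.sum_const, Finset.card_range, Nat.cast_smul_eq_nsmul]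
      _ ≤ (bigT Q ε γ : ℝ) • 1 :=
          smul_le_smul_of_nonneg_right (Nat.cast_le.mpr ht.1.le) zero_le_one
  rw [bigW_eq_exp_neg_sum_loss]
  refine exp_smul_one_le_exp (neg_sum_loss_isHermitian Q ε γ e t) ?_
  rw [neg_smul, neg_le_neg_iff, mul_smul]
  exact smul_le_smul_of_nonneg_left hsum (by positivity)

theorem hsInner_normalize_phiStar_Y_sub_le (hQ : 0 ≤ Q) (hunit : IsUnit Q) (hε : 0 < ε) {t : ℕ}
    (hcontinue : ¬ (e t).AcceptTest Q ε γ) {V : BiOp M N} {w τ : ℝ} (hw : 0 < w)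
    (hW : w • 1 ≤ bigW Q ε γ e t) (hV : 0 ≤ V) (hV_trace : 0 < V.trace.re)
    (hdist : ‖V - bigW Q ε γ e t‖ ≤ τ) :
    hsInner (normalize V) (PhiStar Q ((e t).Y γ)) -
      hsInner (normalize (bigW Q ε γ e t)) (PhiStar Q ((e t).Y γ)) ≤
        2 * τ / w / delta Q ε := by
  have hstable := trace_mul_div_trace_sub_le hw hW hV hV_trace hdist
    (loss_nonneg hunit hε hcontinue) (loss_le_one hQ hunit hε hcontinue)
  rw [loss, Matrix.mul_smul, Matrix.mul_smul, trace_smul_re, trace_smul_re, mul_div_assoc,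
    mul_div_assoc, ← mul_sub, ← le_div_iff₀' (delta_pos hunit hε)] at hstable
  rwa [hsInner_normalize hV.isSelfAdjoint.isHermitian,
    hsInner_normalize (bigW_nonneg Q ε γ e t).isSelfAdjoint.isHermitian]

theorem IsApproxRun.acceptPrecision_and_rejectPrecision {τ : ℝ} (he : IsApproxRun Q ε γ τ e)
    (hQ : 0 ≤ Q) (hunit : IsUnit Q) (hε : 0 < ε) (hγ : 0 < γ)
    (hτ_weight : τ < Real.exp (-(ε * γ / 2 * bigT Q ε γ)))
    (hτ_accept : τ ≤ delta Q ε / (4 * N * ‖Q⁻¹‖))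
    (hτ_reject : τ * (2 / Real.exp (-(ε * γ / 2 * bigT Q ε γ)) / delta Q ε + γ) <
      (ε * γ / 2) ^ 2 / 12) {t : ℕ} (ht : Reached Q ε γ e t) :
    AcceptPrecision Q ε (e t) ∧
      (¬ (e t).AcceptTest Q ε γ → RejectPrecision Q ε γ e t) := by
  obtain ⟨⟨V, hV_isHermitian, hdist, hρ⟩, herr⟩ := he t ht
  have hW := exp_smul_one_le_bigW hQ hunit hε hγ ht
  have hV_ge := smul_one_le_of_norm_sub_le hW
    (hV_isHermitian.sub (bigW_nonneg Q ε γ e t).isSelfAdjoint.isHermitian) hdist.le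
  have hV : 0 ≤ V := (smul_nonneg (sub_pos.mpr hτ_weight).le zero_le_one).trans hV_ge
  have hV_trace := trace_re_pos_of_smul_one_le (sub_pos.mpr hτ_weight) hV_ge
  have hdensity : IsDensity (e t).rho := hρ ▸ isDensity_normalize hV hV_trace
  refine ⟨⟨hdensity, herr.trans_le hτ_accept⟩, fun hcontinue => ?_⟩
  have hstored := one_sub_le_hsInner_phiStar_Y hdensity.1.isHermitian
    (smallS_pos hunit hε hcontinue) herr.le
  have hexact := hsInner_normalize_phiStar_Y_sub_le hQ hunit hε hcontinue (Real.exp_pos _) hW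
    hV hV_trace hdist.le
  rw [mul_comm 2 τ, mul_div_assoc, mul_div_assoc] at hexact
  rw [RejectPrecision]
  rw [hρ] at hstored
  linarith

theorem exists_precision (hQ : IsInteractiveMeasurement Q) (hunit : IsUnit Q) (hε : 0 < ε)
    (hγ : 0 < γ) :
    ∃ τ : ℝ, 0 < τ ∧ ∀ e : ℕ → Record M N, IsApproxRun Q ε γ τ e →
      ∀ t, Reached Q ε γ e t → AcceptPrecision Q ε (e t) ∧
        (¬ (e t).AcceptTest Q ε γ → RejectPrecision Q ε γ e t) := by
  have hδ := delta_pos hunit hε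
  have hinv := hQ.one_le_norm_inv hunit
  have hN : (0 : ℝ) < N := Nat.cast_pos.mpr (NeZero.pos N)
  set w := Real.exp (-(ε * γ / 2 * bigT Q ε γ))
  have hw : 0 < w := Real.exp_pos _
  have hslope : 0 < 2 / w / delta Q ε + γ := by positivity
  have haccept : 0 < delta Q ε / (4 * N * ‖Q⁻¹‖) := by positivity
  have hreject : 0 < (ε * γ / 2) ^ 2 / 12 / (2 / w / delta Q ε + γ) := by positivity
  obtain ⟨τ, hτ, hτ_lt⟩ := exists_between (lt_min hw (lt_min haccept hreject))
  obtain ⟨hτ_weight, hτ_accept, hτ_reject⟩ := by simpa only [lt_min_iff] using hτ_lt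
  exact ⟨τ, hτ, fun e he t ht => he.acceptPrecision_and_rejectPrecision hQ.nonneg hunit hε hγ
    hτ_weight hτ_accept.le ((lt_div_iff₀ hslope).mp hτ_reject) ht⟩

end ApproximateRuns

end QIP2

open QIP2 in
theorem mainTheorem2 (M N : ℕ) (hMN : 2 ≤ N * M)
    (Q : BiOp M N) (hQ : IsInteractiveMeasurement Q) (hQinv : IsUnit Q)
    (ε γ : ℝ) (hε : 0 < ε) (hγ : 0 < γ) :
    -- `μ(Q)` is a maximum, and it is stable under perturbations of `Q`
    IsGreatest (acceptanceValues Q) (mu Q) ∧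
    (∀ R : BiOp M N, 0 ≤ R →
      |mu Q - mu R| ≤ N * ‖Q - R‖ ∧ (‖Q - R‖ < ε * γ / N → |mu Q - mu R| < ε * γ)) ∧
    -- the number of iterations
    (∀ e : ℕ → Record M N, iterations Q ε γ e ≤ bigT Q ε γ ∧
      ((∃ t, AcceptsAt Q ε γ e t) ∨ Rejects Q ε γ e)) ∧
    (ε ≤ 1 → γ ≤ 1 →
      (bigT Q ε γ : ℝ) ≤ 25 * (Real.log ((N : ℝ) * M) / (ε ^ 3 * γ ^ 3 * delta Q ε))) ∧
    -- the error-free algorithm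
    (∃ e : ℕ → Record M N, IsExactRun Q ε γ e) ∧
    (∀ e : ℕ → Record M N, IsExactRun Q ε γ e →
      ((∃ t, AcceptsAt Q ε γ e t) →
        (∃ X : BiOp M N, PrimalFeasible Q X ∧ (1 - ε) * γ ≤ X.trace.re) ∧
          (1 - ε) * γ ≤ mu Q) ∧
      (Rejects Q ε γ e →
        (∃ Y : Op N, DualFeasible Q Y ∧ Y.trace.re ≤ (1 + ε) * γ) ∧
          mu Q ≤ (1 + ε) * γ)) ∧
    -- the algorithm with limited precision
    (∀ e : ℕ → Record M N,
      (∀ t, AcceptsAt Q ε γ e t → AcceptPrecision Q ε (e t) →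
        (∃ X : BiOp M N, PrimalFeasible Q X ∧ (1 - 2 * ε) * γ ≤ X.trace.re) ∧
          (1 - 2 * ε) * γ ≤ mu Q) ∧
      (Rejects Q ε γ e → (∀ t < bigT Q ε γ, RejectPrecision Q ε γ e t) →
        (∃ Y : Op N, DualFeasible Q Y ∧ Y.trace.re ≤ (1 + ε) * γ) ∧
          mu Q ≤ (1 + ε) * γ)) ∧
    -- sufficiently accurate exponentials and spectral decompositions give that precision
    (∃ τ : ℝ, 0 < τ ∧ ∀ e : ℕ → Record M N, IsApproxRun Q ε γ τ e →
      ∀ t, Reached Q ε γ e t → AcceptPrecision Q ε (e t) ∧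
        (¬ (e t).AcceptTest Q ε γ → RejectPrecision Q ε γ e t)) := by
  have : NeZero M := ⟨by rintro rfl; simp at hMN⟩
  have : NeZero N := ⟨by rintro rfl; simp at hMN⟩
  have hprimal {c : ℝ} (h : ∃ X : BiOp M N, PrimalFeasible Q X ∧ c ≤ X.trace.re) :
      (∃ X : BiOp M N, PrimalFeasible Q X ∧ c ≤ X.trace.re) ∧ c ≤ mu Q :=
    ⟨h, let ⟨_, hX, hc⟩ := h; hc.trans (hX.trace_le_mu hQ.nonneg hQinv)⟩
  have hdual {c : ℝ} (h : ∃ Y : Op N, DualFeasible Q Y ∧ Y.trace.re ≤ c) :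
      (∃ Y : Op N, DualFeasible Q Y ∧ Y.trace.re ≤ c) ∧ mu Q ≤ c :=
    ⟨h, let ⟨_, hY, hc⟩ := h; (hY.mu_le_trace hQ.nonneg hQinv).trans hc⟩
  exact ⟨isGreatest_mu Q, fun R _ => ⟨abs_mu_sub_mu_le Q R, abs_mu_sub_mu_lt⟩,
    fun e => ⟨iterations_le_bigT Q ε γ e, accepts_or_rejects Q ε γ e⟩,
    bigT_le hMN hQinv hε hγ,
    exists_exactRun Q ε γ,
    fun e he => ⟨fun ⟨t, ht⟩ => hprimal (he.exists_primalFeasible hQ.nonneg hQinv hε hγ ht),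
      fun hrej => hdual (he.exists_dualFeasible hMN hQ hQinv hε hγ hrej)⟩,
    fun e => ⟨fun t ht hprec =>
        hprimal (exists_primalFeasible_of_acceptPrecision hQ hQinv hε hγ hprec ht.2),
      fun hrej hprec => hdual (exists_dualFeasible_of_rejects hMN hQ hQinv hε hγ hrej hprec)⟩,
    exists_precision hQ hQinv hε hγ⟩
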